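/- **Setting.** Let $Q$ be a smooth finite-dimensional manifold and let $G$ be a Lie group with Lie algebra $\mathfrak g$ acting smoothly and freely on the left on $Q$, such that $\pi:Q\to Q/G$ is a smooth principal $G$-bundle. Let $(Q,L_d,\mathcal D,\mathcal D_d)$ be a nonholonomic discrete mechanical system: $L_d:Q\times Q\to\mathbb R$ is smooth, $\mathcal D\subset TQ$ is a subbundle and $\mathcal D_d\subset Q\times Q$ is a submanifold. Assume that $G$ is a symmetry group, i.e. $L_d$ and $\mathcal D_d$ are invariant under the diagonal action and $\mathcal D$ is invariant under the lifted action. *Connection.* Let $\mathcal V_q=T_q(Gq)=\{\xi_Q(q):\xi\in\mathfrak g\}$ be the vertical bundle and assume that $\mathcal S=\mathcal V\cap\mathcal D$ has locally constant rank. Let $\mathcal H,\mathcal U,\mathcal W\subset TQ$ be $G$-invariant subbundles with $\mathcal D=\mathcal S\oplus\mathcal H$, $\mathcal V=\mathcal S\oplus\mathcal U$ and $TQ=\mathcal W\oplus(\mathcal D+\mathcal V)$. Let $\mathcal A$ be the (nonholonomic) connection on $\pi$ with horizontal space $\mathcal W\oplus\mathcal H$, with horizontal lift $h^q:T_{\pi(q)}(Q/G)\to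 T_qQ$ and horizontal part $\mathrm{Hor}_{\mathcal A}(\delta q)=h^q(d\pi(q)\delta q)$. *Affine discrete connection.* Let $\gamma:Q\to G$ be smooth with $\gamma(gq)=g\gamma(q)g^{-1}$, and put $\Gamma=\{(q,\gamma(q)q):q\in Q\}$. Let $Hor\subset Q\times Q$ be a $G$-invariant submanifold containing $\Gamma$ such that, for each $q$, $Hor^2(q)=\{q_1:(q,q_1)\in Hor\}$ is a submanifold of $Q$ with $T_{q_1}Q=T_{q_1}(Gq)\oplus T_{q_1}Hor^2(q)$ for all $q_1\in Gq\cap Hor^2(q)$. Let $U\subset Q\times Q$ be a $G$-invariant open neighbourhood of $\Gamma$. The discrete connection form is defined by $\mathcal A_d(q_0,q_1)=g$, where $g$ is the unique element of $G$ with $(q_0,g^{-1}q_1)\in Hor\cap U$. Its domain is the largest open subset of $Q\times Q$ on which such a unique $g$ exists and $\mathcal A_d$ is smooth. *Reduced objects.* Let $\rho:Q\times G\to\tilde G=(Q\times G)/G$ be the quotient by $g\cdot(q,w)=(gq,gwg^{-1})$. Let $\tilde F_1(q_0,w_0,r_1)=w_0q'$, where $q'$ is the unique point with $(q_0,q')\in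 Hor\cap U$ and $\pi(q')=r_1$. Set $\check L_d(q_0,w_0,r_1)=L_d(q_0,\tilde F_1(q_0,w_0,r_1))$, $\hat L_d(\rho(q_0,w_0),r_1)=\check L_d(q_0,w_0,r_1)$ and $$S_d(q_\cdot)=\sum_{k=0}^{N-1}L_d(q_k,q_{k+1}),\qquad \hat S_d(v_\cdot,r_\cdot)=\sum_{k=0}^{N-1}\hat L_d(v_k,r_{k+1}).$$ Write $D_j$ for the differential in the $j$-th variable. Let $\mathcal B_m^-(q_0,q_1)(\delta q_0)=D_1\mathcal A_d(q_0,q_1)(\mathrm{Hor}_{\mathcal A}(\delta q_0))$ and $\mathcal B_m^+(q_0,q_1)(\delta q_1)=D_2\mathcal A_d(q_0,q_1)(\mathrm{Hor}_{\mathcal A}(\delta q_1))$ be the components of the mixed curvature. The reduced discrete forces are $$\hat F_d^-(\rho(q_0,w_0),r_1)=D_2\check L_d(q_0,w_0,r_1)\circ \mathcal B_m^-(q_0,q_1)\circ h^{q_0},\qquad \hat F_d^+(\rho(q_0,w_0),r_1)=D_2\check L_d(q_0,w_0,r_1)\circ \mathcal B_m^+(q_0,q_1)\circ h^{q_1},$$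 with $q_1=\tilde F_1(q_0,w_0,r_1)$. Let $\hat{\mathcal D}_d\subset\tilde G\times Q/G$ be the image of the part of $\mathcal D_d$ in the domain of $\mathcal A_d$ under $(q_0,q_1)\mapsto(\rho(q_0,\mathcal A_d(q_0,q_1)),\pi(q_1))$. Put $\mathfrak g^{\mathcal D}_q=\{\xi\in\mathfrak g:\xi_Q(q)\in\mathcal D_q\}$. For $\alpha\in T^*_wG$ let $\alpha w^{-1}\in\mathfrak g^*$ be $\xi\mapsto\alpha(dR_w(e)\xi)$. **Theorem.** Let $q_\cdot=(q_0,\dots,q_N)$ be a discrete curve in $Q$ such that $(q_k,q_{k+1})$ is in the domain of $\mathcal A_d$ for $0\le k<N$. Put $r_k=\pi(q_k)$, $w_k=\mathcal A_d(q_k,q_{k+1})$, $v_k=\rho(q_k,w_k)$ and $\hat{\mathcal D}_{r_k}=d\pi(q_k)(\mathcal D_{q_k})$. The following are equivalent. 1. $(q_k,q_{k+1})\in\mathcal D_d$ for $0\le k<N$, and $dS_d(q_\cdot)(\delta q_\cdot)=0$ for all $\delta q_\cdot$ with $\delta q_k\in\mathcal D_{q_k}$ for all $k$ and $\delta q_0=0$,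 $\delta q_N=0$. 2. $(q_k,q_{k+1})\in\mathcal D_d$ for $0\le k<N$, and $D_1L_d(q_k,q_{k+1})+D_2L_d(q_{k-1},q_k)$ vanishes on $\mathcal D_{q_k}$ for $0<k<N$. 3. $(v_k,r_{k+1})\in\hat{\mathcal D}_d$ for $0\le k<N$, and $d\hat S_d(v_\cdot,r_\cdot)(\delta v_\cdot,\delta r_\cdot)=0$ for all variations such that $\delta r_k\in\hat{\mathcal D}_{r_k}$ for $0\le k\le N$ and $$\begin{aligned}\delta v_k={}&d\rho(q_k,w_k)\big(h^{q_k}(\delta r_k),\,d\mathcal A_d(q_k,q_{k+1})(h^{q_k}(\delta r_k),h^{q_{k+1}}(\delta r_{k+1}))\big)\\&+d\rho(q_k,w_k)\big((\xi_k)_Q(q_k),\,d\mathcal A_d(q_k,q_{k+1})((\xi_k)_Q(q_k),(\xi_{k+1})_Q(q_{k+1}))\big)\end{aligned}$$ for $0\le k<N$, with $\xi_k\in\mathfrak g^{\mathcal D}_{q_k}$ for $0\le k\le N$, and with vanishing end points: $\delta r_0=0$, $\delta r_N=0$, $\xi_0=\xi_N=0$. 4. $(v_k,r_{k+1})\in\hat{\mathcal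 D}_d$ for $0\le k<N$ and, for $0<k<N$, $$\phi=D_1\check L_d(q_k,w_k,r_{k+1})\circ h^{q_k}+D_3\check L_d(q_{k-1},w_{k-1},r_k)+\hat F_d^-(v_k,r_{k+1})+\hat F_d^+(v_{k-1},r_k)\in T^*_{r_k}(Q/G)$$ vanishes on $\hat{\mathcal D}_{r_k}$, and $$\psi=D_2\check L_d(q_{k-1},w_{k-1},r_k)\,w_{k-1}^{-1}-D_2\check L_d(q_k,w_k,r_{k+1})\,w_k^{-1}\in\mathfrak g^*$$ vanishes on $\mathfrak g^{\mathcal D}_{q_k}$. -/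

import Mathlib

open scoped Manifold ContDiff Topology

set_option linter.unusedSectionVars false

noncomputable section

namespace DiscreteMechanics

/-! ### Submanifolds, subbundles and real-valued differentials -/

section General

variable {E H M : Type*} [NormedAddCommGroup E] [NormedSpace ℝ E] [TopologicalSpace H]
  [TopologicalSpace M] [ChartedSpace H M]

/-- `S` is an embedded smooth submanifold: around each of its points there is a smooth chart of the
ambient manifold in which `S` is a linear slice. -/
def IsSubmanifold (I : ModelWithCorners ℝ E H) (S : Set M) : Prop :=
  ∀ p ∈ S, ∃ φ ∈ IsManifold.maximalAtlas I ∞ M, p ∈ φ.source ∧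
    ∃ F : Submodule ℝ E, ∀ x ∈ φ.source, x ∈ S ↔ I (φ x) ∈ F

/-- The tangent space `T_p S ⊆ T_p M` of a submanifold `S` of `M`: the span of the velocities
at `p` of the smooth curves through `p` that stay in `S`. -/
def tangentSpaceOf (I : ModelWithCorners ℝ E H) (S : Set M) (p : M) :
    Submodule ℝ (TangentSpace I p) :=
  Submodule.span ℝ {v | ∃ c : ℝ → M, ContMDiffAt 𝓘(ℝ, ℝ) I ∞ c 0 ∧ c 0 = p ∧
    (∀ᶠ t in 𝓝 (0 : ℝ), c t ∈ S) ∧ (mfderiv 𝓘(ℝ, ℝ) I c 0 (1 : ℝ) : E) = v}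

/-- A family of subspaces of the tangent spaces is a smooth subbundle of the tangent bundle:
locally it has a smooth frame. -/
def IsSubbundle (I : ModelWithCorners ℝ E H) [IsManifold I ∞ M]
    (D : ∀ p : M, Submodule ℝ (TangentSpace I p)) :
    Prop :=
  ∀ p : M, ∃ U : Set M, IsOpen U ∧ p ∈ U ∧
    ∃ (m : ℕ) (X : Fin m → ∀ x : M, TangentSpace I x),
      (∀ i, ContMDiffOn I I.tangent ∞ (fun x => (⟨x, X i x⟩ : TangentBundle I M)) U) ∧
      ∀ x ∈ U, LinearIndependent ℝ (fun i => X i x) ∧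
        Submodule.span ℝ (Set.range fun i => X i x) = D x

/-- The differential `df(p)` of a real function, as a covector at `p`. -/
def dReal (I : ModelWithCorners ℝ E H) (f : M → ℝ) (p : M) : TangentSpace I p →L[ℝ] ℝ :=
  mfderiv I 𝓘(ℝ, ℝ) f p

end General

/-! ### Principal bundles -/

section Principal

/-- The orbit space `Q/G`, with the quotient topology. -/
abbrev OrbitSpace (G Q : Type*) [Group G] [MulAction G Q] : Type _ :=
  MulAction.orbitRel.Quotient G Q

/-- The quotient map `π : Q → Q/G`. -/
def proj (G : Type*) {Q : Type*} [Group G] [MulAction G Q] (q : Q) : OrbitSpace G Q :=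
  Quotient.mk _ q

variable (EQ EG EB : Type*) (G Q : Type*)
  [NormedAddCommGroup EQ] [NormedSpace ℝ EQ] [NormedAddCommGroup EG] [NormedSpace ℝ EG]
  [NormedAddCommGroup EB] [NormedSpace ℝ EB]
  [TopologicalSpace G] [ChartedSpace EG G] [Group G]
  [TopologicalSpace Q] [ChartedSpace EQ Q] [MulAction G Q]
  [ChartedSpace EB (OrbitSpace G Q)]

/-- The Lie group `G` acts smoothly and freely on the left on `Q`, and `π : Q → Q/G` is a (smooth,
locally trivial) principal bundle: every point of `Q/G` has an open neighbourhood `U` with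
a `G`-equivariant diffeomorphism `π⁻¹(U) ≃ U × G` over `U`. -/
structure IsPrincipalBundle : Prop where
  smooth_smul : ContMDiff (𝓘(ℝ, EG).prod 𝓘(ℝ, EQ)) 𝓘(ℝ, EQ) ∞ (fun p : G × Q => p.1 • p.2)
  free : ∀ (g : G) (q : Q), g • q = q → g = 1
  locally_trivial : ∀ r : OrbitSpace G Q, ∃ e : OpenPartialHomeomorph Q (OrbitSpace G Q × G),
    (∃ U : Set (OrbitSpace G Q), IsOpen U ∧ r ∈ U ∧
      e.source = proj G ⁻¹' U ∧ e.target = U ×ˢ Set.univ) ∧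
    (∀ q ∈ e.source, (e q).1 = proj G q) ∧
    (∀ q ∈ e.source, ∀ g : G, (e (g • q)).2 = g * (e q).2) ∧
    ContMDiffOn 𝓘(ℝ, EQ) (𝓘(ℝ, EB).prod 𝓘(ℝ, EG)) ∞ e e.source ∧
    ContMDiffOn (𝓘(ℝ, EB).prod 𝓘(ℝ, EG)) 𝓘(ℝ, EQ) ∞ e.symm e.target

end Principal

/-! ### The conjugate associated bundle -/

section Conjugate

variable {EQ EG EB : Type*} {G Q : Type*}
  [NormedAddCommGroup EQ] [NormedSpace ℝ EQ] [NormedAddCommGroup EG] [NormedSpace ℝ EG]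
  [NormedAddCommGroup EB] [NormedSpace ℝ EB]
  [TopologicalSpace G] [ChartedSpace EG G] [Group G]
  [TopologicalSpace Q] [ChartedSpace EQ Q] [MulAction G Q]
  [ChartedSpace EB (OrbitSpace G Q)]

theorem proj_eq_iff {q q' : Q} : proj G q = proj G q' ↔ ∃ g : G, g • q' = q := by
  unfold proj
  rw [Quotient.eq]
  rfl

@[simp] theorem proj_smul (g : G) (q : Q) : proj G (g • q) = proj G q :=
  proj_eq_iff.2 ⟨g, rfl⟩

/-- Orbit equivalence for the action `g • (q, w) = (g • q, g w g⁻¹)` of `G` on `Q × G`. -/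
def conjSetoid (G Q : Type*) [Group G] [MulAction G Q] : Setoid (Q × G) where
  r a b := ∃ g : G, b.1 = g • a.1 ∧ b.2 = g * a.2 * g⁻¹
  iseqv :=
    { refl := fun a => ⟨1, by simp, by simp⟩
      symm := by
        rintro ⟨q, w⟩ ⟨q', w'⟩ ⟨g, h1, h2⟩
        dsimp only at h1 h2
        subst h1 h2
        exact ⟨g⁻¹, by simp, by simp [mul_assoc]⟩
      trans := by
        rintro ⟨q, w⟩ ⟨q', w'⟩ ⟨q'', w''⟩ ⟨g, h1, h2⟩ ⟨k, h3, h4⟩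
        dsimp only at h1 h2 h3 h4
        subst h1 h2 h3 h4
        exact ⟨k * g, by simp [mul_smul], by simp [mul_assoc]⟩ }

/-- The conjugate associated bundle `G̃ = (Q × G)/G`. -/
def ConjBundle (_hP : IsPrincipalBundle EQ EG EB G Q) : Type _ := Quotient (conjSetoid G Q)

variable (hP : IsPrincipalBundle EQ EG EB G Q)

instance : TopologicalSpace (ConjBundle hP) :=
  inferInstanceAs (TopologicalSpace (Quotient (conjSetoid G Q)))

/-- The quotient map `ρ : Q × G → G̃`. -/
def rho (p : Q × G) : ConjBundle hP := Quotient.mk (conjSetoid G Q) p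

/-- The bundle projection `G̃ → Q/G`. -/
def ConjBundle.base (v : ConjBundle hP) : OrbitSpace G Q :=
  Quotient.lift (fun p : Q × G => proj G p.1)
    (by rintro a b ⟨g, h, -⟩; simp [h]) v

/-- A representative `(q, w)` of a point of `G̃`. -/
def ConjBundle.rep (v : ConjBundle hP) : Q × G :=
  @Quotient.out (Q × G) (conjSetoid G Q) v

theorem rho_rep (v : ConjBundle hP) : rho hP (v.rep hP) = v :=
  @Quotient.out_eq (Q × G) (conjSetoid G Q) v

@[simp] theorem base_rho (p : Q × G) : (rho hP p).base hP = proj G p.1 := rfl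

theorem rho_eq_iff {p p' : Q × G} :
    rho hP p = rho hP p' ↔ ∃ g : G, p'.1 = g • p.1 ∧ p'.2 = g * p.2 * g⁻¹ :=
  Quotient.eq (r := conjSetoid G Q)

theorem rho_conj (g : G) (q : Q) (w : G) :
    rho hP (g • q, g * w * g⁻¹) = rho hP (q, w) :=
  ((rho_eq_iff hP).2 ⟨g, rfl, rfl⟩).symm


theorem isQuotientMap_rho : Topology.IsQuotientMap (rho hP) :=
  @isQuotientMap_quot_mk (Q × G) _ _

theorem continuous_proj : Continuous (proj G : Q → OrbitSpace G Q) :=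
  continuous_quotient_mk'

theorem continuous_base : Continuous (ConjBundle.base hP) := by
  rw [(isQuotientMap_rho hP).continuous_iff]
  exact continuous_proj.comp continuous_fst

/-- A chosen local trivialization of `π : Q → Q/G` around `r`. -/
def IsPrincipalBundle.triv (r : OrbitSpace G Q) :
    OpenPartialHomeomorph Q (OrbitSpace G Q × G) := (hP.locally_trivial r).choose

/-- The open set of `Q/G` over which the chosen trivialization around `r` is defined. -/
def IsPrincipalBundle.dom (r : OrbitSpace G Q) : Set (OrbitSpace G Q) :=
  (hP.locally_trivial r).choose_spec.1.choose

section triv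

variable (r : OrbitSpace G Q)

theorem isOpen_dom : IsOpen (hP.dom r) := (hP.locally_trivial r).choose_spec.1.choose_spec.1

theorem mem_dom : r ∈ hP.dom r := (hP.locally_trivial r).choose_spec.1.choose_spec.2.1

theorem triv_source : (hP.triv r).source = proj G ⁻¹' hP.dom r :=
  (hP.locally_trivial r).choose_spec.1.choose_spec.2.2.1

theorem triv_target : (hP.triv r).target = hP.dom r ×ˢ Set.univ :=
  (hP.locally_trivial r).choose_spec.1.choose_spec.2.2.2

theorem triv_fst {q : Q} (hq : proj G q ∈ hP.dom r) : (hP.triv r q).1 = proj G q :=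
  (hP.locally_trivial r).choose_spec.2.1 q ((triv_source hP r).symm ▸ hq : q ∈ (hP.triv r).source)

theorem triv_snd {q : Q} (hq : proj G q ∈ hP.dom r) (g : G) :
    (hP.triv r (g • q)).2 = g * (hP.triv r q).2 :=
  (hP.locally_trivial r).choose_spec.2.2.1 q
    ((triv_source hP r).symm ▸ hq : q ∈ (hP.triv r).source) g

theorem triv_smooth : ContMDiffOn 𝓘(ℝ, EQ) (𝓘(ℝ, EB).prod 𝓘(ℝ, EG)) ∞ (hP.triv r)
    (hP.triv r).source := (hP.locally_trivial r).choose_spec.2.2.2.1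

theorem triv_symm_smooth : ContMDiffOn (𝓘(ℝ, EB).prod 𝓘(ℝ, EG)) 𝓘(ℝ, EQ) ∞ (hP.triv r).symm
    (hP.triv r).target := (hP.locally_trivial r).choose_spec.2.2.2.2

/-- The local section of `π` given by the chosen trivialization around `r`. -/
def IsPrincipalBundle.sec (x : OrbitSpace G Q) : Q := (hP.triv r).symm (x, 1)

variable {r}

theorem proj_sec {x : OrbitSpace G Q} (hx : x ∈ hP.dom r) : proj G (hP.sec r x) = x := by
  have ht : (x, (1 : G)) ∈ (hP.triv r).target := by rw [triv_target]; exact ⟨hx, trivial⟩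
  have h1 : hP.sec r x ∈ (hP.triv r).source := (hP.triv r).map_target ht
  rw [triv_source] at h1
  rw [← triv_fst hP r h1, IsPrincipalBundle.sec, (hP.triv r).right_inv ht]

theorem triv_sec {x : OrbitSpace G Q} (hx : x ∈ hP.dom r) : (hP.triv r (hP.sec r x)).2 = 1 := by
  have ht : (x, (1 : G)) ∈ (hP.triv r).target := by rw [triv_target]; exact ⟨hx, trivial⟩
  rw [IsPrincipalBundle.sec, (hP.triv r).right_inv ht]

/-- In the trivialization, `q = τ(q) • s(π(q))`. -/
theorem smul_sec {q : Q} (hq : proj G q ∈ hP.dom r) :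
    (hP.triv r q).2 • hP.sec r (proj G q) = q := by
  have hs := proj_sec hP hq
  have hq' : q ∈ (hP.triv r).source := by rw [triv_source]; exact hq
  refine (hP.triv r).injOn ?_ hq' ?_
  · rw [triv_source, Set.mem_preimage, proj_smul, hs]; exact hq
  · refine Prod.ext ?_ ?_
    · rw [triv_fst hP r hq, triv_fst hP r (by rw [proj_smul, hs]; exact hq), proj_smul, hs]
    · rw [triv_snd hP r (by rw [hs]; exact hq), triv_sec hP hq, mul_one]

end triv

section charts

variable [LieGroup 𝓘(ℝ, EG) ∞ G]

/-- The coordinate `(π(q), τ(q)⁻¹ w τ(q))` of `(q, w)` attached to the trivialization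
`q ↦ (π(q), τ(q))` of `Q` around `r`. -/
def preConjChart (r : OrbitSpace G Q) (p : Q × G) : OrbitSpace G Q × G :=
  (proj G p.1, (hP.triv r p.1).2⁻¹ * p.2 * (hP.triv r p.1).2)

theorem preConjChart_eq {r : OrbitSpace G Q} {p p' : Q × G} (h : rho hP p = rho hP p')
    (hp : proj G p.1 ∈ hP.dom r) : preConjChart hP r p = preConjChart hP r p' := by
  obtain ⟨g, h1, h2⟩ := (rho_eq_iff hP).1 h
  unfold preConjChart
  rw [h1, h2, proj_smul, triv_snd hP r hp]
  simp [mul_assoc]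

theorem preConjChart_smooth (r : OrbitSpace G Q) :
    ContMDiffOn (𝓘(ℝ, EQ).prod 𝓘(ℝ, EG)) (𝓘(ℝ, EB).prod 𝓘(ℝ, EG)) ∞ (preConjChart hP r)
      ((hP.triv r).source ×ˢ Set.univ) := by
  have h0 : ContMDiffOn (𝓘(ℝ, EQ).prod 𝓘(ℝ, EG)) (𝓘(ℝ, EB).prod 𝓘(ℝ, EG)) ∞
      (fun p : Q × G => hP.triv r p.1) ((hP.triv r).source ×ˢ Set.univ) :=
    (triv_smooth hP r).comp contMDiffOn_fst (fun p hp => hp.1)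
  have h2 := contMDiff_snd.comp_contMDiffOn h0
  have h1 := contMDiff_fst.comp_contMDiffOn h0
  refine ContMDiffOn.prodMk (h1.congr fun p hp => ?_) ((h2.inv.mul contMDiffOn_snd).mul h2)
  have := hp.1
  rw [triv_source] at this
  exact (triv_fst hP r this).symm

theorem sec_smooth (r : OrbitSpace G Q) :
    ContMDiffOn 𝓘(ℝ, EB) 𝓘(ℝ, EQ) ∞ (hP.sec r) (hP.dom r) :=
  (triv_symm_smooth hP r).comp (contMDiffOn_id.prodMk contMDiffOn_const)
    (fun x hx => by rw [triv_target]; exact ⟨hx, trivial⟩)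

/-- The local trivialization of `G̃` over `U ⊆ Q/G` induced by one of `Q`:
`ρ(q, w) ↦ (π(q), τ(q)⁻¹ w τ(q))`, with inverse `(x, w) ↦ ρ(s(x), w)`. -/
def conjTriv (r : OrbitSpace G Q) :
    OpenPartialHomeomorph (ConjBundle hP) (OrbitSpace G Q × G) where
  toFun v := preConjChart hP r (v.rep hP)
  invFun y := rho hP (hP.sec r y.1, y.2)
  source := ConjBundle.base hP ⁻¹' hP.dom r
  target := hP.dom r ×ˢ Set.univ
  map_source' v hv := by
    refine ⟨?_, trivial⟩
    rw [← rho_rep hP v] at hv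
    exact hv
  map_target' y hy := by
    change proj G (hP.sec r y.1) ∈ hP.dom r
    rw [proj_sec hP hy.1]
    exact hy.1
  left_inv' v hv := by
    rw [← rho_rep hP v] at hv
    have hv' : proj G (v.rep hP).1 ∈ hP.dom r := hv
    conv_rhs => rw [← rho_rep hP v]
    rw [rho_eq_iff]
    refine ⟨(hP.triv r (v.rep hP).1).2, (smul_sec hP hv').symm, ?_⟩
    simp [preConjChart, mul_assoc]
  right_inv' y hy := by
    have h1 : preConjChart hP r ((rho hP (hP.sec r y.1, y.2)).rep hP) =
        preConjChart hP r (hP.sec r y.1, y.2) := by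
      refine (preConjChart_eq hP (rho_rep hP _).symm ?_).symm
      rw [proj_sec hP hy.1]; exact hy.1
    rw [h1, preConjChart, proj_sec hP hy.1, triv_sec hP hy.1]
    simp
  open_source := (isOpen_dom hP r).preimage (continuous_base hP)
  open_target := (isOpen_dom hP r).prod isOpen_univ
  continuousOn_toFun := by
    rw [(isQuotientMap_rho hP).continuousOn_isOpen_iff
      ((isOpen_dom hP r).preimage (continuous_base hP))]
    refine ((preConjChart_smooth hP r).continuousOn.mono ?_).congr ?_
    · intro p hp
      exact ⟨by rw [triv_source]; exact hp, trivial⟩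
    · intro p hp
      exact (preConjChart_eq hP (rho_rep hP _).symm hp).symm
  continuousOn_invFun := by
    refine (isQuotientMap_rho hP).continuous.comp_continuousOn ?_
    exact ((sec_smooth hP r).continuousOn.comp continuousOn_fst (fun y hy => hy.1)).prodMk
      continuousOn_snd

/-- The smooth structure of `G̃`: its charts are the local trivializations followed by charts
of `Q/G × G`. -/
instance : ChartedSpace (ModelProd EB EG) (ConjBundle hP) where
  atlas := {φ | ∃ (r : OrbitSpace G Q) (ψ : OpenPartialHomeomorph (OrbitSpace G Q × G)
    (ModelProd EB EG)), ψ ∈ atlas (ModelProd EB EG) (OrbitSpace G Q × G) ∧ φ = conjTriv hP r ≫ₕ ψ}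
  chartAt v := conjTriv hP (v.base hP) ≫ₕ
    chartAt (ModelProd EB EG) (conjTriv hP (v.base hP) v)
  mem_chart_source v := by
    rw [OpenPartialHomeomorph.trans_source]
    exact ⟨mem_dom hP _, mem_chart_source (ModelProd EB EG) (conjTriv hP (v.base hP) v)⟩
  chart_mem_atlas v := ⟨_, _, chart_mem_atlas _ _, rfl⟩

/-- The transition maps between the local trivializations of `G̃` are smooth. -/
theorem conjTriv_transition (r r' : OrbitSpace G Q) :
    ContMDiffOn (𝓘(ℝ, EB).prod 𝓘(ℝ, EG)) (𝓘(ℝ, EB).prod 𝓘(ℝ, EG)) ∞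
      (conjTriv hP r' ∘ (conjTriv hP r).symm) ((hP.dom r ∩ hP.dom r') ×ˢ Set.univ) := by
  have h0 : ContMDiffOn (𝓘(ℝ, EB).prod 𝓘(ℝ, EG)) (𝓘(ℝ, EQ).prod 𝓘(ℝ, EG)) ∞
      (fun y : OrbitSpace G Q × G => (hP.sec r y.1, y.2))
      ((hP.dom r ∩ hP.dom r') ×ˢ Set.univ) :=
    ((sec_smooth hP r).comp contMDiffOn_fst (fun y hy => hy.1.1)).prodMk contMDiffOn_snd
  refine ((preConjChart_smooth hP r').comp h0 ?_).congr ?_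
  · intro y hy
    refine ⟨?_, trivial⟩
    rw [triv_source, Set.mem_preimage, proj_sec hP hy.1.1]
    exact hy.1.2
  · intro y hy
    refine (preConjChart_eq hP (rho_rep hP _).symm ?_).symm
    rw [proj_sec hP hy.1.1]
    exact hy.1.2

instance [IsManifold 𝓘(ℝ, EB) ∞ (OrbitSpace G Q)] :
    IsManifold (𝓘(ℝ, EB).prod 𝓘(ℝ, EG)) ∞ (ConjBundle hP) := by
  refine isManifold_of_contDiffOn _ _ _ ?_
  rintro _ _ ⟨r, ψ, hψ, rfl⟩ ⟨r', ψ', hψ', rfl⟩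
  have hm := contMDiffOn_of_mem_maximalAtlas (I := 𝓘(ℝ, EB).prod 𝓘(ℝ, EG)) (n := ∞)
    (IsManifold.subset_maximalAtlas hψ')
  have hm' := contMDiffOn_symm_of_mem_maximalAtlas (I := 𝓘(ℝ, EB).prod 𝓘(ℝ, EG)) (n := ∞)
    (IsManifold.subset_maximalAtlas hψ)
  set e := (conjTriv hP r ≫ₕ ψ).symm ≫ₕ (conjTriv hP r' ≫ₕ ψ') with he
  have key : ContMDiffOn (𝓘(ℝ, EB).prod 𝓘(ℝ, EG)) (𝓘(ℝ, EB).prod 𝓘(ℝ, EG)) ∞ e e.source := by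
    have hsrc : ∀ y ∈ e.source, y ∈ ψ.target ∧ ψ.symm y ∈ (hP.dom r ∩ hP.dom r') ×ˢ Set.univ ∧
        conjTriv hP r' ((conjTriv hP r).symm (ψ.symm y)) ∈ ψ'.source := by
      intro y hy
      simp only [he, OpenPartialHomeomorph.trans_symm_eq_symm_trans_symm, mfld_simps] at hy
      obtain ⟨⟨h1, h2⟩, h3, h4⟩ := hy
      have h2' : (ψ.symm y).1 ∈ hP.dom r := h2.1
      refine ⟨h1, ⟨⟨h2', ?_⟩, trivial⟩, h4⟩
      have h5 : proj G (hP.sec r (ψ.symm y).1) ∈ hP.dom r' := h3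
      rwa [proj_sec hP h2'] at h5
    exact (hm.comp ((conjTriv_transition hP r r').comp (hm'.mono fun y hy => (hsrc y hy).1)
      (fun y hy => (hsrc y hy).2.1)) (fun y hy => (hsrc y hy).2.2))
  rw [← contMDiffOn_iff_contDiffOn]
  refine (𝓘(ℝ, EB).prod 𝓘(ℝ, EG)).contMDiff.comp_contMDiffOn (key.comp
    ((𝓘(ℝ, EB).prod 𝓘(ℝ, EG)).contMDiffOn_symm.mono Set.inter_subset_right) fun y hy => hy.1)

/-- `ρ : Q × G → G̃` is smooth. -/
theorem rho_smooth [IsManifold 𝓘(ℝ, EB) ∞ (OrbitSpace G Q)] :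
    ContMDiff (𝓘(ℝ, EQ).prod 𝓘(ℝ, EG)) (𝓘(ℝ, EB).prod 𝓘(ℝ, EG)) ∞ (rho hP) := by
  intro p
  have hp : proj G p.1 ∈ hP.dom (proj G p.1) := mem_dom hP _
  have hn : (hP.triv (proj G p.1)).source ×ˢ (Set.univ : Set G) ∈ 𝓝 p := by
    refine ((hP.triv _).open_source.prod isOpen_univ).mem_nhds ⟨?_, trivial⟩
    rw [triv_source]; exact hp
  have heq : ∀ p' ∈ (hP.triv (proj G p.1)).source ×ˢ (Set.univ : Set G),
      conjTriv hP (proj G p.1) (rho hP p') = preConjChart hP (proj G p.1) p' := by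
    intro p' hp'
    have := hp'.1
    rw [triv_source] at this
    exact (preConjChart_eq hP (rho_rep hP _).symm this).symm
  rw [contMDiffAt_iff_target]
  refine ⟨(isQuotientMap_rho hP).continuous.continuousAt, ?_⟩
  have h1 : ContMDiffAt (𝓘(ℝ, EQ).prod 𝓘(ℝ, EG)) 𝓘(ℝ, EB × EG) ∞
      (extChartAt (𝓘(ℝ, EB).prod 𝓘(ℝ, EG)) (preConjChart hP (proj G p.1) p) ∘
        preConjChart hP (proj G p.1)) p :=
    contMDiffAt_extChartAt.comp p ((preConjChart_smooth hP _).contMDiffAt hn)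
  refine h1.congr_of_eventuallyEq ?_
  filter_upwards [hn] with p' hp'
  change (𝓘(ℝ, EB).prod 𝓘(ℝ, EG)) (chartAt (ModelProd EB EG)
    (conjTriv hP (proj G p.1) (rho hP p)) (conjTriv hP (proj G p.1) (rho hP p'))) = _
  rw [heq p' hp', heq p (mem_of_mem_nhds hn)]
  rfl

end charts

end Conjugate

/-! ### Discrete mechanical systems with symmetry -/

section Systems

/-- A nonholonomic discrete mechanical system `(Q, L_d, 𝒟, 𝒟_d)`. -/
structure DiscreteSystem (EQ Q : Type*) [NormedAddCommGroup EQ] [NormedSpace ℝ EQ]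
    [TopologicalSpace Q] [ChartedSpace EQ Q] [IsManifold 𝓘(ℝ, EQ) ∞ Q] where
  /-- the discrete lagrangian `L_d` -/
  L : Q × Q → ℝ
  /-- the variational constraints `𝒟 ⊆ TQ` -/
  D : ∀ q : Q, Submodule ℝ (TangentSpace 𝓘(ℝ, EQ) q)
  /-- the discrete kinematic constraints `𝒟_d ⊆ Q × Q` -/
  Dd : Set (Q × Q)
  smooth_L : ContMDiff (𝓘(ℝ, EQ).prod 𝓘(ℝ, EQ)) 𝓘(ℝ, ℝ) ∞ L
  subbundle_D : IsSubbundle 𝓘(ℝ, EQ) D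
  submanifold_Dd : IsSubmanifold (𝓘(ℝ, EQ).prod 𝓘(ℝ, EQ)) Dd

variable {EQ EG EB : Type*} {G Q : Type*}
  [NormedAddCommGroup EQ] [NormedSpace ℝ EQ] [NormedAddCommGroup EG] [NormedSpace ℝ EG]
  [NormedAddCommGroup EB] [NormedSpace ℝ EB]
  [TopologicalSpace G] [ChartedSpace EG G] [Group G]
  [TopologicalSpace Q] [ChartedSpace EQ Q] [IsManifold 𝓘(ℝ, EQ) ∞ Q] [MulAction G Q]
  [ChartedSpace EB (OrbitSpace G Q)]

/-- The lifted action of `g` on tangent vectors of `Q`. -/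
def liftedAction (g : G) (q : Q) :
    TangentSpace 𝓘(ℝ, EQ) q →L[ℝ] TangentSpace 𝓘(ℝ, EQ) (g • q) :=
  mfderiv 𝓘(ℝ, EQ) 𝓘(ℝ, EQ) (fun x : Q => g • x) q

variable (EQ EG G) in
/-- The infinitesimal generator `ξ ↦ ξ_Q(q)`: the differential at `1` of `g ↦ g • q`. -/
def infGen (q : Q) : GroupLieAlgebra 𝓘(ℝ, EG) G →L[ℝ] TangentSpace 𝓘(ℝ, EQ) q :=
  mfderiv 𝓘(ℝ, EG) 𝓘(ℝ, EQ) (fun g : G => g • q) (1 : G)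

variable (EQ EG G) in
/-- The vertical space `𝒱_q`, tangent to the orbit of `q`. -/
def vertical (q : Q) : Submodule ℝ (TangentSpace 𝓘(ℝ, EQ) q) :=
  LinearMap.range (infGen EQ EG G q).toLinearMap

variable (EQ EB G) in
/-- The differential `dπ(q) : T_q Q → T_{π(q)}(Q/G)`. -/
def dproj (q : Q) : TangentSpace 𝓘(ℝ, EQ) q →L[ℝ] TangentSpace 𝓘(ℝ, EB) (proj G q) :=
  mfderiv 𝓘(ℝ, EQ) 𝓘(ℝ, EB) (proj G) q

variable (G) in
/-- A family of tangent subspaces is `G`-invariant for the lifted action. -/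
def IsInvariant (D : ∀ q : Q, Submodule ℝ (TangentSpace 𝓘(ℝ, EQ) q)) : Prop :=
  ∀ (g : G) (q : Q), ∀ v ∈ D q, liftedAction g q v ∈ D (g • q)

variable (G) in
/-- `G` is a symmetry group of the system: `L_d`, `𝒟` and `𝒟_d` are `G`-invariant. -/
structure DiscreteSystem.IsSymmetric (sys : DiscreteSystem EQ Q) : Prop where
  L_inv : ∀ (g : G) (q₀ q₁ : Q), sys.L (g • q₀, g • q₁) = sys.L (q₀, q₁)
  D_inv : IsInvariant G sys.D
  Dd_inv : ∀ (g : G) (q₀ q₁ : Q), (q₀, q₁) ∈ sys.Dd → (g • q₀, g • q₁) ∈ sys.Dd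

variable (EG G) in
/-- A `G`-invariant splitting `TQ = 𝒲 ⊕ 𝒰 ⊕ 𝒮 ⊕ ℋ` with `𝒮 = 𝒱 ∩ 𝒟` of locally constant rank,
`𝒟 = 𝒮 ⊕ ℋ` and `𝒱 = 𝒮 ⊕ 𝒰`. -/
structure NonholonomicSplitting (sys : DiscreteSystem EQ Q) where
  W : ∀ q : Q, Submodule ℝ (TangentSpace 𝓘(ℝ, EQ) q)
  U : ∀ q : Q, Submodule ℝ (TangentSpace 𝓘(ℝ, EQ) q)
  H : ∀ q : Q, Submodule ℝ (TangentSpace 𝓘(ℝ, EQ) q)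
  rank_S : IsLocallyConstant fun q : Q => Module.finrank ℝ ↥(vertical EQ EG G q ⊓ sys.D q)
  subbundle_W : IsSubbundle 𝓘(ℝ, EQ) W
  subbundle_U : IsSubbundle 𝓘(ℝ, EQ) U
  subbundle_H : IsSubbundle 𝓘(ℝ, EQ) H
  W_inv : IsInvariant G W
  U_inv : IsInvariant G U
  H_inv : IsInvariant G H
  disjoint_S_H : ∀ q, Disjoint (vertical EQ EG G q ⊓ sys.D q) (H q)
  sup_S_H : ∀ q, (vertical EQ EG G q ⊓ sys.D q) ⊔ H q = sys.D q
  disjoint_S_U : ∀ q, Disjoint (vertical EQ EG G q ⊓ sys.D q) (U q)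
  sup_S_U : ∀ q, (vertical EQ EG G q ⊓ sys.D q) ⊔ U q = vertical EQ EG G q
  isCompl_W : ∀ q, IsCompl (W q) (sys.D q ⊔ vertical EQ EG G q)

namespace NonholonomicSplitting

variable {sys : DiscreteSystem EQ Q} (spl : NonholonomicSplitting EG G sys)

/-- The horizontal space `Hor_𝒜(q) = 𝒲_q ⊕ ℋ_q` of the nonholonomic connection `𝒜`. -/
def hor (q : Q) : Submodule ℝ (TangentSpace 𝓘(ℝ, EQ) q) := spl.W q ⊔ spl.H q

variable (EB) in
/-- The horizontal lift `h^q : T_{π(q)}(Q/G) → T_q Q` of `𝒜`, that is, the inverse of the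
isomorphism `dπ(q) : Hor_𝒜(q) → T_{π(q)}(Q/G)`. -/
def horLift (q : Q) : TangentSpace 𝓘(ℝ, EB) (proj G q) →L[ℝ] TangentSpace 𝓘(ℝ, EQ) q :=
  (spl.hor q).subtypeL ∘L (dproj EQ EB G q ∘L (spl.hor q).subtypeL).inverse

variable (EB) in
/-- The `𝒜`-horizontal part of tangent vectors at `q`. -/
def horPart (q : Q) : TangentSpace 𝓘(ℝ, EQ) q →L[ℝ] TangentSpace 𝓘(ℝ, EQ) q :=
  spl.horLift EB q ∘L dproj EQ EB G q

end NonholonomicSplitting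

end Systems

/-! ### Affine discrete connections -/

section Connections

/-- An affine discrete connection on `π : Q → Q/G`, of level `γ` and horizontal manifold `Hor`,
together with the invariant open neighbourhood `nbd` of `Γ = {(q, γ(q) • q)}` in which the
horizontal elements are taken when the associated discrete connection form is defined. -/
structure AffineDiscreteConnection (EQ EG G Q : Type*)
    [NormedAddCommGroup EQ] [NormedSpace ℝ EQ] [NormedAddCommGroup EG] [NormedSpace ℝ EG]
    [TopologicalSpace G] [ChartedSpace EG G] [Group G]
    [TopologicalSpace Q] [ChartedSpace EQ Q] [IsManifold 𝓘(ℝ, EQ) ∞ Q] [MulAction G Q] where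
  /-- the level `γ` -/
  level : Q → G
  smooth_level : ContMDiff 𝓘(ℝ, EQ) 𝓘(ℝ, EG) ∞ level
  level_smul : ∀ (g : G) (q : Q), level (g • q) = g * level q * g⁻¹
  Hor : Set (Q × Q)
  submanifold_Hor : IsSubmanifold (𝓘(ℝ, EQ).prod 𝓘(ℝ, EQ)) Hor
  Hor_inv : ∀ (g : G) (q₀ q₁ : Q), (q₀, q₁) ∈ Hor → (g • q₀, g • q₁) ∈ Hor
  graph_subset_Hor : ∀ q, (q, level q • q) ∈ Hor
  submanifold_fiber : ∀ q, IsSubmanifold 𝓘(ℝ, EQ) {q₁ | (q, q₁) ∈ Hor}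
  transversal : ∀ (q : Q) (g : G), (q, g • q) ∈ Hor →
    IsCompl (vertical EQ EG G (g • q)) (tangentSpaceOf 𝓘(ℝ, EQ) {q₁ | (q, q₁) ∈ Hor} (g • q))
  nbd : Set (Q × Q)
  isOpen_nbd : IsOpen nbd
  nbd_inv : ∀ (g : G) (q₀ q₁ : Q), (q₀, q₁) ∈ nbd → (g • q₀, g • q₁) ∈ nbd
  graph_subset_nbd : ∀ q, (q, level q • q) ∈ nbd

variable {EQ EG EB : Type*} {G Q : Type*}
  [NormedAddCommGroup EQ] [NormedSpace ℝ EQ] [NormedAddCommGroup EG] [NormedSpace ℝ EG]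
  [NormedAddCommGroup EB] [NormedSpace ℝ EB]
  [TopologicalSpace G] [ChartedSpace EG G] [Group G]
  [TopologicalSpace Q] [ChartedSpace EQ Q] [IsManifold 𝓘(ℝ, EQ) ∞ Q] [MulAction G Q]
  [ChartedSpace EB (OrbitSpace G Q)]

namespace AffineDiscreteConnection

variable (A : AffineDiscreteConnection EQ EG G Q)

/-- There is a unique `g` with `(q₀, q₁) = (q₀, g • q₀) · (q₀, g⁻¹ • q₁)` where
`(q₀, g⁻¹ • q₁)` is a horizontal element in `nbd`. -/
def Decomposes (p : Q × Q) : Prop := ∃! g : G, (p.1, g⁻¹ • p.2) ∈ A.Hor ∩ A.nbd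

open Classical in
/-- The discrete connection `1`-form `𝒜_d`; it is meaningful on `A.domain`. -/
def form (p : Q × Q) : G := if h : A.Decomposes p then h.choose else 1

/-- The domain of `𝒜_d`: the largest open set on which it is well defined and smooth. -/
def domain : Set (Q × Q) :=
  {p | ∀ᶠ p' in 𝓝 p, A.Decomposes p' ∧
    ContMDiffAt (𝓘(ℝ, EQ).prod 𝓘(ℝ, EQ)) 𝓘(ℝ, EG) ∞ A.form p'}

open Classical in
/-- The (second component of the) discrete horizontal lift: `q₁ = hlift q₀ r₁` iff `(q₀, q₁)`
is horizontal and `π(q₁) = r₁`. -/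
def hlift (q₀ : Q) (r₁ : OrbitSpace G Q) : Q :=
  if h : ∃! q₁ : Q, (q₀, q₁) ∈ A.Hor ∩ A.nbd ∧ proj G q₁ = r₁ then h.choose else q₀

theorem mem_Hor_nbd_iff (g : G) (q₀ q₁ : Q) :
    (g • q₀, g • q₁) ∈ A.Hor ∩ A.nbd ↔ (q₀, q₁) ∈ A.Hor ∩ A.nbd := by
  refine ⟨fun h => ?_, fun h => ⟨A.Hor_inv g _ _ h.1, A.nbd_inv g _ _ h.2⟩⟩
  have h1 := A.Hor_inv g⁻¹ _ _ h.1
  have h2 := A.nbd_inv g⁻¹ _ _ h.2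
  simp only [inv_smul_smul] at h1 h2
  exact ⟨h1, h2⟩

theorem hlift_smul (g : G) (q₀ : Q) (r₁ : OrbitSpace G Q) :
    A.hlift (g • q₀) r₁ = g • A.hlift q₀ r₁ := by
  have key : ∀ (g : G) (q₀ : Q), (∃! q₁ : Q, (q₀, q₁) ∈ A.Hor ∩ A.nbd ∧ proj G q₁ = r₁) →
      ∃! q₁ : Q, (g • q₀, q₁) ∈ A.Hor ∩ A.nbd ∧ proj G q₁ = r₁ := by
    rintro g q₀ ⟨q₁, ⟨h1, h2⟩, h3⟩
    refine ⟨g • q₁, ⟨(A.mem_Hor_nbd_iff g _ _).2 h1, by rw [proj_smul, h2]⟩, ?_⟩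
    rintro y ⟨hy1, hy2⟩
    have := h3 (g⁻¹ • y) ⟨(A.mem_Hor_nbd_iff g _ _).1 (by rwa [smul_inv_smul]),
      by rw [proj_smul, hy2]⟩
    rw [← this, smul_inv_smul]
  unfold hlift
  by_cases h : ∃! q₁ : Q, (q₀, q₁) ∈ A.Hor ∩ A.nbd ∧ proj G q₁ = r₁
  · have h' := key g q₀ h
    rw [dif_pos h, dif_pos h']
    refine h'.unique h'.choose_spec.1 ⟨(A.mem_Hor_nbd_iff g _ _).2 h.choose_spec.1.1, ?_⟩
    rw [proj_smul, h.choose_spec.1.2]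
  · have h' : ¬ ∃! q₁ : Q, (g • q₀, q₁) ∈ A.Hor ∩ A.nbd ∧ proj G q₁ = r₁ := by
      intro h'
      have := key g⁻¹ _ h'
      rw [inv_smul_smul] at this
      exact h this
    rw [dif_neg h, dif_neg h']

/-- The map `F̃₁(q₀, w₀, r₁) = w₀ • hlift q₀ r₁`. -/
def F1 (q₀ : Q) (w₀ : G) (r₁ : OrbitSpace G Q) : Q := w₀ • A.hlift q₀ r₁

theorem F1_smul (g : G) (q₀ : Q) (w₀ : G) (r₁ : OrbitSpace G Q) :
    A.F1 (g • q₀) (g * w₀ * g⁻¹) r₁ = g • A.F1 q₀ w₀ r₁ := by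
  simp [F1, hlift_smul, mul_smul]

variable (hP : IsPrincipalBundle EQ EG EB G Q)

/-- The map `Υ(q₀, q₁) = (ρ(q₀, 𝒜_d(q₀, q₁)), π(q₁))` from `Q × Q` to `G̃ × Q/G`; it is the
composition of the quotient map to `(Q × Q)/G` with `Φ_{𝒜_d}`. -/
def Upsilon (p : Q × Q) : ConjBundle hP × OrbitSpace G Q :=
  (rho hP (p.1, A.form p), proj G p.2)

/-- The differential `d𝒜_d(q₀, q₁)(δq₀, δq₁)`. -/
def dform (p : Q × Q) (δ₀ : TangentSpace 𝓘(ℝ, EQ) p.1) (δ₁ : TangentSpace 𝓘(ℝ, EQ) p.2) :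
    TangentSpace 𝓘(ℝ, EG) (A.form p) :=
  mfderiv (𝓘(ℝ, EQ).prod 𝓘(ℝ, EQ)) 𝓘(ℝ, EG) A.form p (δ₀, δ₁)

/-- The partial differential `D₁𝒜_d(q₀, q₁)`. -/
def d1form (q₀ q₁ : Q) :
    TangentSpace 𝓘(ℝ, EQ) q₀ →L[ℝ] TangentSpace 𝓘(ℝ, EG) (A.form (q₀, q₁)) :=
  mfderiv 𝓘(ℝ, EQ) 𝓘(ℝ, EG) (fun x => A.form (x, q₁)) q₀

/-- The partial differential `D₂𝒜_d(q₀, q₁)`. -/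
def d2form (q₀ q₁ : Q) :
    TangentSpace 𝓘(ℝ, EQ) q₁ →L[ℝ] TangentSpace 𝓘(ℝ, EG) (A.form (q₀, q₁)) :=
  mfderiv 𝓘(ℝ, EQ) 𝓘(ℝ, EG) (fun x => A.form (q₀, x)) q₁

variable {sys : DiscreteSystem EQ Q} (spl : NonholonomicSplitting EG G sys)

variable (EB) in
/-- The mixed curvature `B_m⁻(q₀, q₁)(δq₀) = D₁𝒜_d(q₀, q₁)(Hor_𝒜(δq₀))`. -/
def mixedCurvMinus (q₀ q₁ : Q) :
    TangentSpace 𝓘(ℝ, EQ) q₀ →L[ℝ] TangentSpace 𝓘(ℝ, EG) (A.form (q₀, q₁)) :=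
  A.d1form q₀ q₁ ∘L spl.horPart EB q₀

variable (EB) in
/-- The mixed curvature `B_m⁺(q₀, q₁)(δq₁) = D₂𝒜_d(q₀, q₁)(Hor_𝒜(δq₁))`. -/
def mixedCurvPlus (q₀ q₁ : Q) :
    TangentSpace 𝓘(ℝ, EQ) q₁ →L[ℝ] TangentSpace 𝓘(ℝ, EG) (A.form (q₀, q₁)) :=
  A.d2form q₀ q₁ ∘L spl.horPart EB q₁

end AffineDiscreteConnection

end Connections

/-! ### Lagrangians, forces and actions -/

section Reduced

variable {EQ EG EB : Type*} {G Q : Type*}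
  [NormedAddCommGroup EQ] [NormedSpace ℝ EQ] [NormedAddCommGroup EG] [NormedSpace ℝ EG]
  [NormedAddCommGroup EB] [NormedSpace ℝ EB]
  [TopologicalSpace G] [ChartedSpace EG G] [Group G] [LieGroup 𝓘(ℝ, EG) ∞ G]
  [TopologicalSpace Q] [ChartedSpace EQ Q] [IsManifold 𝓘(ℝ, EQ) ∞ Q] [MulAction G Q]
  [ChartedSpace EB (OrbitSpace G Q)]

/-- For a covector `α` at `w`, the covector `α w⁻¹` at `1`, given by `ξ ↦ α(ξ w)` where
`ξ w = dR_w(1)(ξ)`. -/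
def covecMulInv (w : G) (α : TangentSpace 𝓘(ℝ, EG) w →L[ℝ] ℝ) :
    GroupLieAlgebra 𝓘(ℝ, EG) G →L[ℝ] ℝ :=
  α ∘L (mfderiv 𝓘(ℝ, EG) 𝓘(ℝ, EG) (fun g : G => g * w) (1 : G) :
    GroupLieAlgebra 𝓘(ℝ, EG) G →L[ℝ] TangentSpace 𝓘(ℝ, EG) w)

/-- The differential `dρ(q, w)(δq, δw)`. -/
def drho (hP : IsPrincipalBundle EQ EG EB G Q) (q : Q) (w : G)
    (δq : TangentSpace 𝓘(ℝ, EQ) q) (δw : TangentSpace 𝓘(ℝ, EG) w) :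
    TangentSpace (𝓘(ℝ, EB).prod 𝓘(ℝ, EG)) (rho hP (q, w)) :=
  mfderiv (𝓘(ℝ, EQ).prod 𝓘(ℝ, EG)) (𝓘(ℝ, EB).prod 𝓘(ℝ, EG)) (rho hP) (q, w) (δq, δw)

namespace DiscreteSystem

variable (sys : DiscreteSystem EQ Q) (A : AffineDiscreteConnection EQ EG G Q)

/-- `D₁L_d(q₀, q₁)` -/
def D1L (q₀ q₁ : Q) : TangentSpace 𝓘(ℝ, EQ) q₀ →L[ℝ] ℝ :=
  dReal 𝓘(ℝ, EQ) (fun x => sys.L (x, q₁)) q₀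

/-- `D₂L_d(q₀, q₁)` -/
def D2L (q₀ q₁ : Q) : TangentSpace 𝓘(ℝ, EQ) q₁ →L[ℝ] ℝ :=
  dReal 𝓘(ℝ, EQ) (fun x => sys.L (q₀, x)) q₁

/-- `Ľ_d(q₀, w₀, r₁) = L_d(q₀, F̃₁(q₀, w₀, r₁))` -/
def checkL (q₀ : Q) (w₀ : G) (r₁ : OrbitSpace G Q) : ℝ := sys.L (q₀, A.F1 q₀ w₀ r₁)

/-- `D₁Ľ_d(q₀, w₀, r₁)` -/
def D1checkL (q₀ : Q) (w₀ : G) (r₁ : OrbitSpace G Q) : TangentSpace 𝓘(ℝ, EQ) q₀ →L[ℝ] ℝ :=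
  dReal 𝓘(ℝ, EQ) (fun x => sys.checkL A x w₀ r₁) q₀

/-- `D₂Ľ_d(q₀, w₀, r₁)` -/
def D2checkL (q₀ : Q) (w₀ : G) (r₁ : OrbitSpace G Q) : TangentSpace 𝓘(ℝ, EG) w₀ →L[ℝ] ℝ :=
  dReal 𝓘(ℝ, EG) (fun x => sys.checkL A q₀ x r₁) w₀

/-- `D₃Ľ_d(q₀, w₀, r₁)` -/
def D3checkL (q₀ : Q) (w₀ : G) (r₁ : OrbitSpace G Q) : TangentSpace 𝓘(ℝ, EB) r₁ →L[ℝ] ℝ :=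
  dReal 𝓘(ℝ, EB) (fun x => sys.checkL A q₀ w₀ x) r₁

variable (hP : IsPrincipalBundle EQ EG EB G Q)

/-- The reduced lagrangian `L̂_d(ρ(q₀, w₀), r₁) = Ľ_d(q₀, w₀, r₁)` on `G̃ × Q/G`. -/
def hatL {sys : DiscreteSystem EQ Q} (hS : sys.IsSymmetric G)
    (v : ConjBundle hP) (r : OrbitSpace G Q) : ℝ :=
  Quotient.lift (fun p : Q × G => sys.checkL A p.1 p.2 r)
    (by
      rintro a b ⟨g, h1, h2⟩
      simp only [checkL, h1, h2, A.F1_smul, hS.L_inv]) v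

/-- The reduced kinematic constraints `𝒟̂_d = Φ_{𝒜_d}(𝒟_d/G)`. -/
def hatDd : Set (ConjBundle hP × OrbitSpace G Q) := A.Upsilon hP '' (sys.Dd ∩ A.domain)

variable {sys} (spl : NonholonomicSplitting EG G sys)

variable (EB) in
/-- `D₂Ľ_d(q₀, w₀, r₁) ∘ B_m⁻(q₀, q₁) ∘ h^{q₀}`, where `q₁ = F̃₁(q₀, w₀, r₁)`. -/
def checkForceMinus (q₀ : Q) (w₀ : G) (r₁ : OrbitSpace G Q) :
    TangentSpace 𝓘(ℝ, EB) (proj G q₀) →L[ℝ] ℝ :=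
  (sys.D2checkL A q₀ w₀ r₁ : EG →L[ℝ] ℝ) ∘L
    (A.mixedCurvMinus EB spl q₀ (A.F1 q₀ w₀ r₁) : EQ →L[ℝ] EG) ∘L
    (spl.horLift EB q₀ : EB →L[ℝ] EQ)

variable (EB) in
/-- `D₂Ľ_d(q₀, w₀, r₁) ∘ B_m⁺(q₀, q₁) ∘ h^{q₁}`, where `q₁ = F̃₁(q₀, w₀, r₁)` is such
that `π(q₁) = r₁`. -/
def checkForcePlus (q₀ : Q) (w₀ : G) (r₁ : OrbitSpace G Q) :
    TangentSpace 𝓘(ℝ, EB) r₁ →L[ℝ] ℝ :=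
  (sys.D2checkL A q₀ w₀ r₁ : EG →L[ℝ] ℝ) ∘L
    (A.mixedCurvPlus EB spl q₀ (A.F1 q₀ w₀ r₁) : EQ →L[ℝ] EG) ∘L
    (spl.horLift EB (A.F1 q₀ w₀ r₁) : EB →L[ℝ] EQ)

/-- The reduced discrete force `F̂_d⁻` on `G̃ × Q/G`, computed with a representative `(q₀, w₀)`
of `v₀` (by equivariance it does not depend on the representative). -/
def forceMinus (v₀ : ConjBundle hP) (r₁ : OrbitSpace G Q) :
    TangentSpace 𝓘(ℝ, EB) (v₀.base hP) →L[ℝ] ℝ :=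
  (checkForceMinus EB A spl (v₀.rep hP).1 (v₀.rep hP).2 r₁ : EB →L[ℝ] ℝ)

/-- The reduced discrete force `F̂_d⁺` on `G̃ × Q/G`, computed with a representative `(q₀, w₀)`
of `v₀` (by equivariance it does not depend on the representative). -/
def forcePlus (v₀ : ConjBundle hP) (r₁ : OrbitSpace G Q) :
    TangentSpace 𝓘(ℝ, EB) r₁ →L[ℝ] ℝ :=
  checkForcePlus EB A spl (v₀.rep hP).1 (v₀.rep hP).2 r₁

end DiscreteSystem

end Reduced

/-! ### Discrete curves: variational principles and equations -/

section Curves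

variable {EQ EG EB : Type*} {G Q : Type*}
  [NormedAddCommGroup EQ] [NormedSpace ℝ EQ] [NormedAddCommGroup EG] [NormedSpace ℝ EG]
  [NormedAddCommGroup EB] [NormedSpace ℝ EB]
  [TopologicalSpace G] [ChartedSpace EG G] [Group G] [LieGroup 𝓘(ℝ, EG) ∞ G]
  [TopologicalSpace Q] [ChartedSpace EQ Q] [IsManifold 𝓘(ℝ, EQ) ∞ Q] [MulAction G Q]
  [ChartedSpace EB (OrbitSpace G Q)] {N : ℕ}

namespace DiscreteSystem

section Unreduced

variable (sys : DiscreteSystem EQ Q)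

/-- The discrete action `S_d(q_·) = ∑_{k<N} L_d(q_k, q_{k+1})`, a function on `Q^{N+1}`. -/
def action (q : Fin (N + 1) → Q) : ℝ := ∑ k : Fin N, sys.L (q k.castSucc, q k.succ)

/-- The kinematic constraints `(q_k, q_{k+1}) ∈ 𝒟_d` for all `k`. -/
def Kinematic (q : Fin (N + 1) → Q) : Prop := ∀ k : Fin N, (q k.castSucc, q k.succ) ∈ sys.Dd

/-- The discrete Lagrange–D'Alembert principle. -/
def VariationalPrinciple (q : Fin (N + 1) → Q) : Prop :=
  sys.Kinematic q ∧
  ∀ δq : ∀ k, TangentSpace 𝓘(ℝ, EQ) (q k), δq 0 = 0 → δq (Fin.last N) = 0 →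
    (∀ k, δq k ∈ sys.D (q k)) →
    dReal (ModelWithCorners.pi fun _ : Fin (N + 1) => 𝓘(ℝ, EQ)) sys.action q δq = 0

/-- The discrete Lagrange–D'Alembert equations: `(q_k, q_{k+1}) ∈ 𝒟_d` for `0 ≤ k < N` and
`D₁L_d(q_k, q_{k+1}) + D₂L_d(q_{k-1}, q_k)` vanishes on `𝒟_{q_k}` for `0 < k < N`
(here `j = k - 1`). -/
def Equations (q : Fin (N + 1) → Q) : Prop :=
  sys.Kinematic q ∧
  ∀ j k : Fin N, j.succ = k.castSucc → ∀ δ ∈ sys.D (q k.castSucc),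
    (sys.D1L (q k.castSucc) (q k.succ) + sys.D2L (q j.castSucc) (q k.castSucc)) δ = 0

end Unreduced

variable (hP : IsPrincipalBundle EQ EG EB G Q) {sys : DiscreteSystem EQ Q}
  (spl : NonholonomicSplitting EG G sys) (A : AffineDiscreteConnection EQ EG G Q)

/-- `w_k = 𝒜_d(q_k, q_{k+1})` -/
def wCurve (q : Fin (N + 1) → Q) (k : Fin N) : G := A.form (q k.castSucc, q k.succ)

/-- `v_k = ρ(q_k, w_k)` -/
def vCurve (q : Fin (N + 1) → Q) (k : Fin N) : ConjBundle hP :=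
  rho hP (q k.castSucc, wCurve A q k)

variable (G) in
/-- `r_k = π(q_k)` -/
def rCurve (q : Fin (N + 1) → Q) (k : Fin (N + 1)) : OrbitSpace G Q := proj G (q k)

/-- The reduced action `Ŝ_d(v_·, r_·) = ∑_{k<N} L̂_d(v_k, r_{k+1})`. -/
def hatAction (hS : sys.IsSymmetric G)
    (c : (Fin N → ConjBundle hP) × (Fin (N + 1) → OrbitSpace G Q)) : ℝ :=
  ∑ k : Fin N, hatL A hP hS (c.1 k) (c.2 k.succ)

variable (sys EB G) in
/-- The reduced variational constraints `𝒟̂_{π(q)} = dπ(q)(𝒟_q)`. -/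
def hatD (q : Q) : Submodule ℝ (TangentSpace 𝓘(ℝ, EB) (proj G q)) :=
  (sys.D q).map (dproj EQ EB G q).toLinearMap

variable (sys EG G) in
/-- The fiber `𝔤^𝒟_q = {ξ ∈ 𝔤 : ξ_Q(q) ∈ 𝒟_q}`. -/
def gD (q : Q) : Submodule ℝ (GroupLieAlgebra 𝓘(ℝ, EG) G) :=
  (sys.D q).comap (infGen EQ EG G q).toLinearMap

/-- The variation `δv_k` of `v_k` determined by `δr_·` and `ξ_·`. -/
def deltaV (q : Fin (N + 1) → Q) (δr : ∀ k, TangentSpace 𝓘(ℝ, EB) (rCurve G q k))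
    (ξ : Fin (N + 1) → GroupLieAlgebra 𝓘(ℝ, EG) G) (k : Fin N) :
    TangentSpace (𝓘(ℝ, EB).prod 𝓘(ℝ, EG)) (vCurve hP A q k) :=
  drho hP (q k.castSucc) (wCurve A q k) (spl.horLift EB (q k.castSucc) (δr k.castSucc))
      (A.dform (q k.castSucc, q k.succ) (spl.horLift EB (q k.castSucc) (δr k.castSucc))
        (spl.horLift EB (q k.succ) (δr k.succ))) +
    drho hP (q k.castSucc) (wCurve A q k) (infGen EQ EG G (q k.castSucc) (ξ k.castSucc))
      (A.dform (q k.castSucc, q k.succ) (infGen EQ EG G (q k.castSucc) (ξ k.castSucc))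
        (infGen EQ EG G (q k.succ) (ξ k.succ)))

/-- The reduced variational principle on `G̃ × Q/G` for `(v_·, r_·)`: the variations have the form
`(δv_·, δr_·)` with `δr_k ∈ 𝒟̂_{r_k}`, `δv_k` given by `δr_·` and `ξ_·` with `ξ_k ∈ 𝔤^𝒟_{q_k}`, and
have vanishing end points, that is, `δr_·` and `ξ_·` vanish at `0` and `N`. -/
def ReducedVariationalPrinciple (hS : sys.IsSymmetric G) (q : Fin (N + 1) → Q) : Prop :=
  (∀ k : Fin N, (vCurve hP A q k, rCurve G q k.succ) ∈ hatDd sys A hP) ∧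
  ∀ (δr : ∀ k, TangentSpace 𝓘(ℝ, EB) (rCurve G q k))
    (ξ : Fin (N + 1) → GroupLieAlgebra 𝓘(ℝ, EG) G),
    δr 0 = 0 → δr (Fin.last N) = 0 → ξ 0 = 0 → ξ (Fin.last N) = 0 →
    (∀ k, δr k ∈ hatD EB G sys (q k)) → (∀ k, ξ k ∈ gD EG G sys (q k)) →
    dReal ((ModelWithCorners.pi fun _ : Fin N => 𝓘(ℝ, EB).prod 𝓘(ℝ, EG)).prod
        (ModelWithCorners.pi fun _ : Fin (N + 1) => 𝓘(ℝ, EB)))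
      (hatAction hP A hS) (vCurve hP A q, rCurve G q) (deltaV hP spl A q δr ξ, δr) = 0

/-- The covector `φ ∈ T*_{r_k}(Q/G)` of the horizontal equation (with `j = k - 1`):
`D₁Ľ_d(q_k, w_k, r_{k+1}) ∘ h^{q_k} + D₃Ľ_d(q_{k-1}, w_{k-1}, r_k)`
`+ F̂_d⁻(v_k, r_{k+1}) + F̂_d⁺(v_{k-1}, r_k)`. -/
def phi (q : Fin (N + 1) → Q) (j k : Fin N) :
    TangentSpace 𝓘(ℝ, EB) (rCurve G q k.castSucc) →L[ℝ] ℝ :=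
  let a : TangentSpace 𝓘(ℝ, EB) (rCurve G q k.castSucc) →L[ℝ] ℝ :=
    sys.D1checkL A (q k.castSucc) (wCurve A q k) (rCurve G q k.succ) ∘L
      spl.horLift EB (q k.castSucc)
  let fMinus : TangentSpace 𝓘(ℝ, EB) (rCurve G q k.castSucc) →L[ℝ] ℝ :=
    forceMinus A hP spl (vCurve hP A q k) (rCurve G q k.succ)
  a + sys.D3checkL A (q j.castSucc) (wCurve A q j) (rCurve G q k.castSucc) +
    fMinus + forcePlus A hP spl (vCurve hP A q j) (rCurve G q k.castSucc)

variable (sys) in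
/-- The covector `ψ ∈ 𝔤*` of the vertical equation (with `j = k - 1`):
`D₂Ľ_d(q_{k-1}, w_{k-1}, r_k) w_{k-1}⁻¹ - D₂Ľ_d(q_k, w_k, r_{k+1}) w_k⁻¹`. -/
def psi (q : Fin (N + 1) → Q) (j k : Fin N) : GroupLieAlgebra 𝓘(ℝ, EG) G →L[ℝ] ℝ :=
  covecMulInv (wCurve A q j)
      (sys.D2checkL A (q j.castSucc) (wCurve A q j) (rCurve G q k.castSucc)) -
    covecMulInv (wCurve A q k)
      (sys.D2checkL A (q k.castSucc) (wCurve A q k) (rCurve G q k.succ))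

/-- The reduced equations: `(v_k, r_{k+1}) ∈ 𝒟̂_d` for `0 ≤ k < N` and, for `0 < k < N`, `φ` vanishes
on `𝒟̂_{r_k}` and `ψ` vanishes on `𝔤^𝒟_{q_k}` (here `j = k - 1`). -/
def ReducedEquations (q : Fin (N + 1) → Q) : Prop :=
  (∀ k : Fin N, (vCurve hP A q k, rCurve G q k.succ) ∈ hatDd sys A hP) ∧
  ∀ j k : Fin N, j.succ = k.castSucc →
    (∀ δ ∈ hatD EB G sys (q k.castSucc), phi hP spl A q j k δ = 0) ∧
    (∀ ξ ∈ gD EG G sys (q k.castSucc), psi sys A q j k ξ = 0)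

end DiscreteSystem

end Curves

end DiscreteMechanics

end

/-! Two facts drive the proof. On the domain of `𝒜_d` the lagrangian factors as `L_d(q₀, q₁) =
Ľ_d(q₀, 𝒜_d(q₀, q₁), π(q₁)) = L̂_d(Υ(q₀, q₁))`, because `F̃₁` recovers `q₁` from these data
(`Decomposes.F1_form`). And every `δq ∈ 𝒟_q` has the form `h^q(δr) + ξ_Q(q)` with `δr = dπ(q)(δq)`
and `ξ ∈ 𝔤^𝒟_q`, while all such sums lie in `𝒟_q` (`exists_decomposition`, `horLift_mem_D`). The
second fact holds since `𝒟 = 𝒮 ⊕ ℋ`: the projection `dπ` kills `𝒮`, and the lift of a vector in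
`dπ(𝒟)` falls back into `ℋ`.

The equivalence 1 ↔ 2 is summation by parts followed by localization at one interior index. For 1 ↔
3, the chain rule shows that the differential of `Ŝ_d` along the variation built from `(δr, ξ)`
equals the differential of `S_d` along `h(δr) + ξ_Q` (`dReal_hatAction_deltaV`), so the two
principles test the same variations.

For 2 ↔ 4, the covector `D₁L_d(q_k, q_{k+1}) + D₂L_d(q_{k-1}, q_k)` is evaluated separately on the
two kinds of summands. On horizontal lifts it is `φ`: differentiating `Ľ_d(q₀, 𝒜_d(q₀, q₁), π(q₁))`
produces, besides the partial differentials in the first and third variables, terms through `𝒜_d`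
that are exactly the forces (`phi_apply`). On generators it is `ψ`: moving `q₁` in its orbit only
left-multiplies `𝒜_d`, and invariance of `L_d` transfers this to `q₀` with a sign (`psi_apply`).

The kinematic constraints correspond because `Υ` separates diagonal orbits in the domain and `𝒟_d`
is invariant (`mem_hatDd_iff`). -/

noncomputable section

namespace DiscreteMechanics

/-! ### Differential calculus on products of manifolds. -/

section Calculus

variable {E H M E' H' M' E'' H'' M'' F K N : Type*}
  [NormedAddCommGroup E] [NormedSpace ℝ E] [TopologicalSpace H] [TopologicalSpace M]
  [ChartedSpace H M] {I : ModelWithCorners ℝ E H}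
  [NormedAddCommGroup E'] [NormedSpace ℝ E'] [TopologicalSpace H'] [TopologicalSpace M']
  [ChartedSpace H' M'] {I' : ModelWithCorners ℝ E' H'}
  [NormedAddCommGroup E''] [NormedSpace ℝ E''] [TopologicalSpace H''] [TopologicalSpace M'']
  [ChartedSpace H'' M''] {I'' : ModelWithCorners ℝ E'' H''}
  [NormedAddCommGroup F] [NormedSpace ℝ F] [TopologicalSpace K] [TopologicalSpace N]
  [ChartedSpace K N] {J : ModelWithCorners ℝ F K}

/-- The chain rule for a function of two variables, in terms of partial differentials. -/
theorem mfderiv_comp₂_apply {f : M × M' → M''} {a : N → M} {b : N → M'} {x : N}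
    (hf : MDifferentiableAt (I.prod I') I'' f (a x, b x)) (ha : MDifferentiableAt J I a x)
    (hb : MDifferentiableAt J I' b x) (v : TangentSpace J x) :
    (mfderiv J I'' (fun y => f (a y, b y)) x v : E'') =
      (mfderiv I I'' (fun z => f (z, b x)) (a x) (mfderiv J I a x v) : E'') +
      (mfderiv I' I'' (fun z => f (a x, z)) (b x) (mfderiv J I' b x v) : E'') := by
  have h1 : mfderiv J I'' (fun y => f (a y, b y)) x v =
      mfderiv (I.prod I') I'' f (a x, b x) (mfderiv J (I.prod I') (fun y => (a y, b y)) x v) :=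
    mfderiv_comp_apply x hf (ha.prodMk hb) v
  rw [h1, mfderiv_prod_eq_add_apply hf, mfderiv_prodMk ha hb]
  rfl

/-- Serves base points known only up to a propositional equality, such as `1 • q` and `q`. -/
theorem mfderiv_comp₂_apply_of_eq {f : M × M' → M''} {a : N → M} {b : N → M'} {x : N} {y : M}
    {z : M'} (hf : MDifferentiableAt (I.prod I') I'' f (y, z)) (ha : MDifferentiableAt J I a x)
    (hb : MDifferentiableAt J I' b x) (hy : a x = y) (hz : b x = z) (v : TangentSpace J x) :
    (mfderiv J I'' (fun t => f (a t, b t)) x v : E'') =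
      (mfderiv I I'' (fun t => f (t, z)) y (mfderiv J I a x v) : E'') +
      (mfderiv I' I'' (fun t => f (y, t)) z (mfderiv J I' b x v) : E'') := by
  subst hy hz
  exact mfderiv_comp₂_apply hf ha hb v

/-- The coordinate projections of a finite product of manifolds are differentiable. -/
theorem hasMFDerivAt_eval {ι : Type*} [Fintype ι] (p : ι → M) (i : ι) :
    HasMFDerivAt (ModelWithCorners.pi fun _ : ι => I) I (fun x : ι → M => x i) p
      (ContinuousLinearMap.proj (R := ℝ) (φ := fun _ : ι => E) i) := by
  refine ⟨(continuous_apply i).continuousAt, ?_⟩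
  have h := (ContinuousLinearMap.proj (R := ℝ) (φ := fun _ : ι => E) i).hasFDerivWithinAt
    (s := Set.range (ModelWithCorners.pi fun _ : ι => I))
    (x := extChartAt (ModelWithCorners.pi fun _ : ι => I) p p)
  -- Product charts act coordinatewise, so in charts the evaluation map is the linear projection
  -- once a chart cancels its inverse on the target.
  refine h.congr_of_eventuallyEq ?_ ?_
  swap
  · exact congrFun ((extChartAt (ModelWithCorners.pi fun _ : ι => I) p).right_inv
      (mem_extChartAt_target p)) i
  filter_upwards [extChartAt_target_mem_nhdsWithin (I := ModelWithCorners.pi fun _ : ι => I) p]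
    with y hy
  have h1 := (extChartAt (ModelWithCorners.pi fun _ : ι => I) p).right_inv hy
  exact congrFun h1 i

/-- The differential of a finite sum of real functions, each composed with some map. -/
theorem dReal_sum_comp {κ : Type} [Fintype κ] {f : κ → M' → ℝ} {e : κ → M → M'} {p : M}
    {e' : ∀ k, TangentSpace I p →L[ℝ] TangentSpace I' (e k p)}
    (hf : ∀ k, MDifferentiableAt I' 𝓘(ℝ, ℝ) (f k) (e k p))
    (he : ∀ k, HasMFDerivAt I I' (e k) p (e' k)) (v : TangentSpace I p) :
    dReal I (fun x => ∑ k, f k (e k x)) p v = ∑ k, dReal I' (f k) (e k p) (e' k v) := by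
  let l : κ → TangentSpace I p →L[ℝ] ℝ := fun k => (dReal I' (f k) (e k p)).comp (e' k)
  have hl : ∀ k, HasMFDerivAt I 𝓘(ℝ, ℝ) (f k ∘ e k) p (l k) := fun k =>
    (hf k).hasMFDerivAt.comp p (he k)
  have h : HasMFDerivAt I 𝓘(ℝ, ℝ) (∑ k, f k ∘ e k) p (∑ k, l k) := by
    apply HasMFDerivAt.sum
    intro k _
    exact hl k
  have h2 : (∑ k, f k ∘ e k) = fun x => ∑ k, f k (e k x) := by
    funext x; simp
  rw [h2] at h
  have h3 : dReal I (fun x => ∑ k, f k (e k x)) p = ∑ k, l k := h.mfderiv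
  rw [h3, sum_apply]
  rfl

end Calculus

/-! ### The principal bundle: `dπ`, local sections and the vertical space. -/

section Bundle

variable {EQ EG EB : Type*} {G Q : Type*}
  [NormedAddCommGroup EQ] [NormedSpace ℝ EQ] [NormedAddCommGroup EG] [NormedSpace ℝ EG]
  [NormedAddCommGroup EB] [NormedSpace ℝ EB]
  [TopologicalSpace G] [ChartedSpace EG G] [Group G]
  [TopologicalSpace Q] [ChartedSpace EQ Q] [MulAction G Q]
  [ChartedSpace EB (OrbitSpace G Q)]

variable (hP : IsPrincipalBundle EQ EG EB G Q)

include hP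

theorem smul_smooth (g : G) : ContMDiff 𝓘(ℝ, EQ) 𝓘(ℝ, EQ) ∞ (fun q : Q => g • q) :=
  hP.smooth_smul.comp (contMDiff_const.prodMk contMDiff_id)

theorem orbitMap_smooth (q : Q) : ContMDiff 𝓘(ℝ, EG) 𝓘(ℝ, EQ) ∞ (fun g : G => g • q) :=
  hP.smooth_smul.comp (contMDiff_id.prodMk contMDiff_const)

theorem triv_source_mem_nhds (q : Q) : (hP.triv (proj G q)).source ∈ 𝓝 q :=
  (hP.triv _).open_source.mem_nhds (by rw [triv_source]; exact mem_dom hP _)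

/-- In a local trivialization `π` is the first component. -/
theorem proj_smooth : ContMDiff 𝓘(ℝ, EQ) 𝓘(ℝ, EB) ∞ (proj G : Q → OrbitSpace G Q) := by
  intro q
  have h := ((triv_smooth hP (proj G q)).contMDiffAt (triv_source_mem_nhds hP q)).fst
  refine h.congr_of_eventuallyEq ?_
  filter_upwards [triv_source_mem_nhds hP q] with x hx
  rw [triv_source] at hx
  exact (triv_fst hP _ hx).symm

/-- The local section of `π` through the point `q`. -/
def IsPrincipalBundle.secAt (q : Q) (x : OrbitSpace G Q) : Q :=
  (hP.triv (proj G q) q).2 • hP.sec (proj G q) x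

theorem secAt_proj (q : Q) : hP.secAt q (proj G q) = q := smul_sec hP (mem_dom hP _)

theorem proj_secAt (q : Q) {x : OrbitSpace G Q} (hx : x ∈ hP.dom (proj G q)) :
    proj G (hP.secAt q x) = x := by
  rw [IsPrincipalBundle.secAt, proj_smul, proj_sec hP hx]

theorem secAt_smooth (q : Q) :
    ContMDiffOn 𝓘(ℝ, EB) 𝓘(ℝ, EQ) ∞ (hP.secAt q) (hP.dom (proj G q)) :=
  (smul_smooth hP _).comp_contMDiffOn
    ((triv_symm_smooth hP _).comp (contMDiffOn_id.prodMk contMDiffOn_const)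
      (fun x hx => by rw [triv_target]; exact ⟨hx, trivial⟩))

theorem dom_mem_nhds (r : OrbitSpace G Q) : hP.dom r ∈ 𝓝 r :=
  (isOpen_dom hP r).mem_nhds (mem_dom hP r)

/-- The differential of the local section through `q` is a right inverse. -/
theorem dproj_surjective (q : Q) : Function.Surjective (dproj EQ EB G q) := by
  intro v
  have h1 : MDifferentiableAt 𝓘(ℝ, EB) 𝓘(ℝ, EQ) (hP.secAt q) (proj G q) :=
    ((secAt_smooth hP q).contMDiffAt (dom_mem_nhds hP _)).mdifferentiableAt (by simp)
  have h2 : MDifferentiableAt 𝓘(ℝ, EQ) 𝓘(ℝ, EB) (proj G : Q → OrbitSpace G Q) q :=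
    (proj_smooth hP).mdifferentiableAt (by simp)
  have h3 := mfderiv_comp_apply_of_eq (proj G q) h2 h1 (secAt_proj hP q) v
  have h4 : (proj G ∘ hP.secAt q) =ᶠ[𝓝 (proj G q)] id := by
    filter_upwards [dom_mem_nhds hP (proj G q)] with x hx using proj_secAt hP q hx
  rw [h4.mfderiv_eq, mfderiv_id] at h3
  exact ⟨_, h3.symm⟩

theorem dproj_infGen (q : Q) (ξ : GroupLieAlgebra 𝓘(ℝ, EG) G) :
    dproj EQ EB G q (infGen EQ EG G q ξ) = 0 := by
  have h1 : MDifferentiableAt 𝓘(ℝ, EG) 𝓘(ℝ, EQ) (fun g : G => g • q) 1 :=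
    (orbitMap_smooth hP q).mdifferentiableAt (by simp)
  have h2 : MDifferentiableAt 𝓘(ℝ, EQ) 𝓘(ℝ, EB) (proj G : Q → OrbitSpace G Q) q :=
    (proj_smooth hP).mdifferentiableAt (by simp)
  have h3 := mfderiv_comp_apply_of_eq (1 : G) h2 h1 (one_smul G q) ξ
  have h4 : (proj G ∘ fun g : G => g • q) = fun _ => proj G q := by
    funext g; exact proj_smul g q
  rw [h4, mfderiv_const] at h3
  exact h3.symm

variable [LieGroup 𝓘(ℝ, EG) ∞ G]

/-- Near `q` one has `x = τ(x) • s(π(x))`. Differentiating along `v` with `dπ(v) = 0`, the section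
contributes nothing, so `v` is the velocity of the orbit map of `s(π(q))` in the direction `dτ(v)`.
-/
theorem mem_vertical_of_dproj_eq_zero {q : Q} {v : TangentSpace 𝓘(ℝ, EQ) q}
    (hv : dproj EQ EB G q v = 0) : v ∈ vertical EQ EG G q := by
  set r := proj G q
  set g₀ := (hP.triv r q).2
  have hq : proj G q ∈ hP.dom r := mem_dom hP _
  have ht : MDifferentiableAt 𝓘(ℝ, EQ) 𝓘(ℝ, EG) (fun x => (hP.triv r x).2) q :=
    ((triv_smooth hP r).contMDiffAt (triv_source_mem_nhds hP q)).snd.mdifferentiableAt (by simp)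
  have h1 : MDifferentiableAt 𝓘(ℝ, EB) 𝓘(ℝ, EQ) (hP.sec r) (proj G q) :=
    ((sec_smooth hP r).contMDiffAt (dom_mem_nhds hP _)).mdifferentiableAt (by simp)
  have h2 : MDifferentiableAt 𝓘(ℝ, EQ) 𝓘(ℝ, EB) (proj G : Q → OrbitSpace G Q) q :=
    (proj_smooth hP).mdifferentiableAt (by simp)
  have hs : MDifferentiableAt 𝓘(ℝ, EQ) 𝓘(ℝ, EQ) (fun x => hP.sec r (proj G x)) q :=
    h1.comp q h2
  have h3 := mfderiv_comp₂_apply (f := fun p : G × Q => p.1 • p.2)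
    (hP.smooth_smul.mdifferentiableAt (by simp)) ht hs v
  have h4 : (fun x => (hP.triv r x).2 • hP.sec r (proj G x)) =ᶠ[𝓝 q] id := by
    filter_upwards [triv_source_mem_nhds hP q] with x hx
    rw [triv_source] at hx
    exact smul_sec hP hx
  have h5 : mfderiv 𝓘(ℝ, EQ) 𝓘(ℝ, EQ) (fun x => hP.sec r (proj G x)) q v = 0 := by
    have := mfderiv_comp_apply q h1 h2 v
    refine this.trans ?_
    have hv' : mfderiv 𝓘(ℝ, EQ) 𝓘(ℝ, EB) (proj G : Q → OrbitSpace G Q) q v = 0 := hv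
    rw [hv', map_zero]
  rw [h4.mfderiv_eq, mfderiv_id, h5, map_zero] at h3
  set η := mfderiv 𝓘(ℝ, EQ) 𝓘(ℝ, EG) (fun x => (hP.triv r x).2) q v
  -- Since `q = g₀ • s(π(q))`, the orbit map of `s(π(q))` is that of `q` after right translation by
  -- `g₀⁻¹`; this brings the velocity from `g₀` to the identity, where `infGen` is defined.
  have h6 : (fun g : G => g • hP.sec r (proj G q)) = (fun g : G => g • q) ∘ fun g => g * g₀⁻¹ := by
    funext g
    have := smul_sec hP hq
    simp only [Function.comp]
    conv_rhs => rw [← this]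
    rw [smul_smul, inv_mul_cancel_right]
  have h7 := mfderiv_comp_apply_of_eq (x := g₀) (f := fun g : G => g * g₀⁻¹) (y := (1 : G))
    (g := fun g : G => g • q)
    ((orbitMap_smooth hP q).mdifferentiableAt (by simp))
    ((contMDiff_mul_right (I := 𝓘(ℝ, EG)) (n := ∞) (a := g₀⁻¹)).mdifferentiableAt (by simp)) (by simp) η
  refine ⟨mfderiv 𝓘(ℝ, EG) 𝓘(ℝ, EG) (fun g : G => g * g₀⁻¹) g₀ η, ?_⟩
  rw [← h6] at h7
  refine h7.symm.trans ?_
  exact (add_zero (M := EQ) _).symm.trans h3.symm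

theorem dproj_eq_zero_iff {q : Q} {v : TangentSpace 𝓘(ℝ, EQ) q} :
    dproj EQ EB G q v = 0 ↔ v ∈ vertical EQ EG G q := by
  refine ⟨mem_vertical_of_dproj_eq_zero hP, ?_⟩
  rintro ⟨ξ, rfl⟩
  exact dproj_infGen hP q ξ

end Bundle

/-! ### The nonholonomic connection: horizontal lifts and the splitting of `𝒟`. -/

section Splitting

/-- A bijective continuous linear map out of a finite-dimensional space is inverted
by `ContinuousLinearMap.inverse`. -/
theorem inverse_apply_of_bijective {V V' : Type*} [NormedAddCommGroup V] [NormedSpace ℝ V]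
    [FiniteDimensional ℝ V] [NormedAddCommGroup V'] [NormedSpace ℝ V'] {f : V →L[ℝ] V'}
    (hf : Function.Bijective f) (v : V) : f.inverse (f v) = v := by
  let e : V ≃ₗ[ℝ] V' := LinearEquiv.ofBijective f.toLinearMap hf
  have : FiniteDimensional ℝ V' := e.finiteDimensional
  have h : f = (e.toContinuousLinearEquiv : V →L[ℝ] V') := by ext x; rfl
  rw [h, ContinuousLinearMap.inverse_equiv]
  exact e.toContinuousLinearEquiv.symm_apply_apply v

variable {EQ EG EB : Type*} {G Q : Type*}
  [NormedAddCommGroup EQ] [NormedSpace ℝ EQ] [NormedAddCommGroup EG] [NormedSpace ℝ EG]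
  [NormedAddCommGroup EB] [NormedSpace ℝ EB]
  [TopologicalSpace G] [ChartedSpace EG G] [Group G]
  [TopologicalSpace Q] [ChartedSpace EQ Q] [IsManifold 𝓘(ℝ, EQ) ∞ Q] [MulAction G Q]
  [ChartedSpace EB (OrbitSpace G Q)] {sys : DiscreteSystem EQ Q}

/-- If `w + h` is vertical with `w ∈ 𝒲` and `h ∈ ℋ ⊆ 𝒟`, then `w ∈ 𝒟 + 𝒱`, so `w = 0`, and then `h ∈
𝒮 ∩ ℋ = 0`. The sum is everything because `𝒟 = 𝒮 ⊕ ℋ` with `𝒮 ⊆ 𝒱`. -/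
theorem NonholonomicSplitting.isCompl_hor_vertical (spl : NonholonomicSplitting EG G sys) (q : Q) :
    IsCompl (spl.hor q) (vertical EQ EG G q) := by
  have hH : spl.H q ≤ sys.D q := spl.sup_S_H q ▸ le_sup_right
  constructor
  · rw [Submodule.disjoint_def]
    intro x hx hv
    obtain ⟨w, hw, h, hh, rfl⟩ := Submodule.mem_sup.1 hx
    have hw' : w ∈ sys.D q ⊔ vertical EQ EG G q := by
      have : w = -h + (w + h) := by abel
      rw [this]
      exact Submodule.add_mem_sup (neg_mem (hH hh)) hv
    have hw0 : w = 0 := (Submodule.disjoint_def.1 (spl.isCompl_W q).disjoint) w hw hw'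
    rw [hw0, zero_add] at hv ⊢
    exact (Submodule.disjoint_def.1 (spl.disjoint_S_H q)) h ⟨hv, hH hh⟩ hh
  · rw [codisjoint_iff, eq_top_iff, ← (spl.isCompl_W q).sup_eq_top]
    refine sup_le ?_ (sup_le ?_ le_sup_right)
    · exact le_sup_left.trans le_sup_left
    · rw [← spl.sup_S_H q]
      exact sup_le (inf_le_left.trans le_sup_right) (le_sup_right.trans le_sup_left)

variable (hP : IsPrincipalBundle EQ EG EB G Q)

include hP

/-- Differentiate `π(g • x) = π(x)`. The ascription to `EB` lets vectors over `π(g • q)` and over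
`π(q)` be compared. -/
theorem dproj_liftedAction [IsManifold 𝓘(ℝ, EB) ∞ (OrbitSpace G Q)]
    (g : G) (q : Q) (v : TangentSpace 𝓘(ℝ, EQ) q) :
    (dproj EQ EB G (g • q) (liftedAction g q v) : EB) = dproj EQ EB G q v := by
  have h1 : MDifferentiableAt 𝓘(ℝ, EQ) 𝓘(ℝ, EQ) (fun x : Q => g • x) q :=
    (smul_smooth hP g).mdifferentiableAt (by simp)
  have h2 : MDifferentiableAt 𝓘(ℝ, EQ) 𝓘(ℝ, EB) (proj G : Q → OrbitSpace G Q) (g • q) :=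
    (proj_smooth hP).mdifferentiableAt (by simp)
  have h3 := mfderiv_comp_apply q h2 h1 v
  have h4 : (proj G ∘ fun x : Q => g • x) = proj G := by
    funext x; exact proj_smul g x
  have h5 : (mfderiv 𝓘(ℝ, EQ) 𝓘(ℝ, EB) (proj G ∘ fun x : Q => g • x) q v : EB) =
      mfderiv 𝓘(ℝ, EQ) 𝓘(ℝ, EB) (proj G : Q → OrbitSpace G Q) q v := by rw [h4]
  exact h3.symm.trans h5

variable [LieGroup 𝓘(ℝ, EG) ∞ G]

namespace NonholonomicSplitting

variable (spl : NonholonomicSplitting EG G sys)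

/-- The kernel of the surjection `dπ(q)` is the vertical space, of which the horizontal space is a
complement. -/
theorem bijective_dproj_hor (q : Q) :
    Function.Bijective (dproj EQ EB G q ∘L (spl.hor q).subtypeL) := by
  constructor
  · rw [injective_iff_map_eq_zero]
    rintro ⟨x, hx⟩ h
    have hv : x ∈ vertical EQ EG G q := mem_vertical_of_dproj_eq_zero hP h
    exact Subtype.ext ((Submodule.disjoint_def.1 (spl.isCompl_hor_vertical q).disjoint) x hx hv)
  · intro u
    obtain ⟨v, rfl⟩ := dproj_surjective hP q u
    have hv : v ∈ spl.hor q ⊔ vertical EQ EG G q := by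
      rw [(spl.isCompl_hor_vertical q).sup_eq_top]; trivial
    obtain ⟨x, hx, y, ⟨ξ, rfl⟩, rfl⟩ := Submodule.mem_sup.1 hv
    refine ⟨⟨x, hx⟩, ?_⟩
    rw [map_add]
    have := dproj_infGen hP q ξ
    refine (add_zero _).symm.trans (congrArg _ this.symm)

variable [FiniteDimensional ℝ EQ]

/-- `ContinuousLinearMap.inverse` is `0` on maps that are not continuous linear equivalences; finite
dimension of `EQ` turns the bijection `dπ` on the horizontal space into one, so the lift is the
intended one. -/
theorem horLift_dproj {q : Q} {v : TangentSpace 𝓘(ℝ, EQ) q} (hv : v ∈ spl.hor q) :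
    spl.horLift EB q (dproj EQ EB G q v) = v := by
  have h := inverse_apply_of_bijective (V := ↥(show Submodule ℝ EQ from spl.hor q)) (V' := EB)
    (f := (dproj EQ EB G q ∘L (spl.hor q).subtypeL)) (spl.bijective_dproj_hor hP q) ⟨v, hv⟩
  exact congrArg Subtype.val h

theorem horLift_mem_hor (q : Q) (u : TangentSpace 𝓘(ℝ, EB) (proj G q)) :
    spl.horLift EB q u ∈ spl.hor q :=
  Subtype.property _

theorem dproj_horLift (q : Q) (u : TangentSpace 𝓘(ℝ, EB) (proj G q)) :
    dproj EQ EB G q (spl.horLift EB q u) = u := by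
  obtain ⟨⟨v, hv⟩, rfl⟩ := (spl.bijective_dproj_hor hP q).2 u
  exact congrArg _ (spl.horLift_dproj hP hv)

theorem horPart_horLift (q : Q) (u : TangentSpace 𝓘(ℝ, EB) (proj G q)) :
    spl.horPart EB q (spl.horLift EB q u) = spl.horLift EB q u :=
  spl.horLift_dproj hP (spl.horLift_mem_hor hP q u)

/-- The translate by `g` of a horizontal lift is horizontal, as `𝒲` and `ℋ` are invariant, and has
the same projection; a horizontal vector is determined by its projection. -/
theorem horLift_smul [IsManifold 𝓘(ℝ, EB) ∞ (OrbitSpace G Q)]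
    (g : G) (q : Q) (u : EB) :
    spl.horLift EB (g • q) u = liftedAction g q (spl.horLift EB q u) := by
  have hm : liftedAction g q (spl.horLift EB q u) ∈ spl.hor (g • q) := by
    obtain ⟨w, hw, h, hh, he⟩ := Submodule.mem_sup.1 (spl.horLift_mem_hor hP q u)
    rw [← he, map_add]
    exact Submodule.add_mem_sup (spl.W_inv g q w hw) (spl.H_inv g q h hh)
  have h1 := spl.horLift_dproj hP hm
  have h2 := dproj_liftedAction hP g q (spl.horLift EB q u)
  rw [spl.dproj_horLift hP q u] at h2
  refine Eq.trans ?_ h1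
  exact congrArg (spl.horLift EB (g • q)) h2.symm

theorem horPart_horLift_smul [IsManifold 𝓘(ℝ, EB) ∞ (OrbitSpace G Q)] (g : G) (q : Q) (u : EB) :
    spl.horPart EB (g • q) (spl.horLift EB (g • q) u) =
      liftedAction g q (spl.horLift EB q u) :=
  (spl.horPart_horLift hP (g • q) u).trans (spl.horLift_smul hP g q u)

/-- The horizontal lift of a reduced variation lies in `𝒟`. -/
theorem horLift_mem_D {q : Q} {u : TangentSpace 𝓘(ℝ, EB) (proj G q)}
    (hu : u ∈ DiscreteSystem.hatD EB G sys q) : spl.horLift EB q u ∈ sys.D q := by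
  obtain ⟨v, hv, rfl⟩ := hu
  have hH : spl.H q ≤ sys.D q := spl.sup_S_H q ▸ le_sup_right
  have hv' : v ∈ (vertical EQ EG G q ⊓ sys.D q) ⊔ spl.H q := by rw [spl.sup_S_H q]; exact hv
  -- With `v = s + h` in `𝒮 ⊕ ℋ`, `dπ` kills `s`, so the lift of `dπ(v)` is `h` itself.
  obtain ⟨s, hs, h, hh, rfl⟩ := Submodule.mem_sup.1 hv'
  have h0 : dproj EQ EB G q s = 0 := (dproj_eq_zero_iff hP).2 hs.1
  have h1 : dproj EQ EB G q (s + h) = dproj EQ EB G q h := by rw [map_add, h0, zero_add]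
  have h2 := spl.horLift_dproj hP (v := h) (Submodule.mem_sup_right hh)
  have h3 : spl.horLift EB q (dproj EQ EB G q (s + h)) = h := by rw [h1, h2]
  exact (congrArg (· ∈ sys.D q) h3).mpr (hH hh)

/-- Every element of `𝒟_q` is the sum of a horizontal lift and of an infinitesimal generator
in `𝒟_q`. -/
theorem exists_decomposition {q : Q} {v : TangentSpace 𝓘(ℝ, EQ) q} (hv : v ∈ sys.D q) :
    ∃ ξ ∈ DiscreteSystem.gD EG G sys q,
      v = spl.horLift EB q (dproj EQ EB G q v) + infGen EQ EG G q ξ := by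
  have hu : dproj EQ EB G q v ∈ DiscreteSystem.hatD EB G sys q := ⟨v, hv, rfl⟩
  have h1 : dproj EQ EB G q (v - spl.horLift EB q (dproj EQ EB G q v)) = 0 := by
    rw [map_sub, spl.dproj_horLift hP, sub_self]
  obtain ⟨ξ, hξ⟩ := mem_vertical_of_dproj_eq_zero hP h1
  have hξ' : infGen EQ EG G q ξ = v - spl.horLift EB q (dproj EQ EB G q v) := hξ
  refine ⟨ξ, ?_, ?_⟩
  · change infGen EQ EG G q ξ ∈ sys.D q
    rw [hξ']
    exact sub_mem hv (spl.horLift_mem_D hP hu)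
  · rw [hξ']; abel

end NonholonomicSplitting

end Splitting

/-! ### The discrete connection form and its inverse `F̃₁`. -/

section ConnectionForm

variable {EQ EG EB : Type*} {G Q : Type*}
  [NormedAddCommGroup EQ] [NormedSpace ℝ EQ] [NormedAddCommGroup EG] [NormedSpace ℝ EG]
  [NormedAddCommGroup EB] [NormedSpace ℝ EB]
  [TopologicalSpace G] [ChartedSpace EG G] [Group G]
  [TopologicalSpace Q] [ChartedSpace EQ Q] [IsManifold 𝓘(ℝ, EQ) ∞ Q] [MulAction G Q]
  [ChartedSpace EB (OrbitSpace G Q)]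

namespace AffineDiscreteConnection

variable (A : AffineDiscreteConnection EQ EG G Q)

variable {A} in
theorem Decomposes.form_mem {p : Q × Q} (h : A.Decomposes p) :
    (p.1, (A.form p)⁻¹ • p.2) ∈ A.Hor ∩ A.nbd := by
  rw [form, dif_pos h]; exact h.choose_spec.1

variable {A} in
theorem Decomposes.eq_form {p : Q × Q} (h : A.Decomposes p) {g : G}
    (hg : (p.1, g⁻¹ • p.2) ∈ A.Hor ∩ A.nbd) : g = A.form p :=
  h.unique hg h.form_mem

/-- Since `(g k)⁻¹ • (g • q₁) = k⁻¹ • q₁`, replacing `q₁` by `g • q₁` keeps the horizontal point and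
left-multiplies the group element by `g`. -/
theorem Decomposes.smul_right {A : AffineDiscreteConnection EQ EG G Q} {q₀ q₁ : Q}
    (h : A.Decomposes (q₀, q₁)) (g : G) : A.Decomposes (q₀, g • q₁) := by
  refine ⟨g * A.form (q₀, q₁), ?_, fun k hk => ?_⟩
  · simpa [mul_smul] using h.form_mem
  · have := h.eq_form (g := g⁻¹ * k) (by simpa [mul_smul] using hk)
    rw [← this, mul_inv_cancel_left]

theorem Decomposes.form_smul_right {A : AffineDiscreteConnection EQ EG G Q} {q₀ q₁ : Q}
    (h : A.Decomposes (q₀, q₁)) (g : G) : A.form (q₀, g • q₁) = g * A.form (q₀, q₁) :=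
  ((h.smul_right g).eq_form (by simpa [mul_smul] using h.form_mem)).symm

theorem Decomposes.smul {A : AffineDiscreteConnection EQ EG G Q} {q₀ q₁ : Q}
    (h : A.Decomposes (q₀, q₁)) (g : G) : A.Decomposes (g • q₀, g • q₁) := by
  refine ⟨g * A.form (q₀, q₁) * g⁻¹, ?_, fun k hk => ?_⟩
  · have := (A.mem_Hor_nbd_iff g _ _).2 h.form_mem
    simpa [mul_smul] using this
  · have := h.eq_form (g := g⁻¹ * k * g) ((A.mem_Hor_nbd_iff g _ _).1
      (by simpa [mul_smul] using hk))
    rw [← this]; group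

/-- The discrete connection form is equivariant. -/
theorem form_smul (g : G) (q₀ q₁ : Q) :
    A.form (g • q₀, g • q₁) = g * A.form (q₀, q₁) * g⁻¹ := by
  by_cases h : A.Decomposes (q₀, q₁)
  · refine ((h.smul g).eq_form ?_).symm
    have := (A.mem_Hor_nbd_iff g _ _).2 h.form_mem
    simpa [mul_smul] using this
  -- Where no decomposition exists both values are the default `1`, which conjugation fixes;
  -- equivariance thus holds on all of `Q × Q`.
  · have h' : ¬ A.Decomposes (g • q₀, g • q₁) := fun h' => h (by simpa using h'.smul g⁻¹)
    simp [form, dif_neg h, dif_neg h']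

/-- A point over `π(q₁)` is some `g • q₁`, and it is horizontal from `q₀` within `nbd` only if `g⁻¹
= 𝒜_d(q₀, q₁)`. Uniqueness of the group element therefore gives uniqueness of the point, and `hlift`
does not take its default value. -/
theorem Decomposes.hlift_proj {A : AffineDiscreteConnection EQ EG G Q} {q₀ q₁ : Q}
    (h : A.Decomposes (q₀, q₁)) :
    A.hlift q₀ (proj G q₁) = (A.form (q₀, q₁))⁻¹ • q₁ := by
  have h1 : (q₀, (A.form (q₀, q₁))⁻¹ • q₁) ∈ A.Hor ∩ A.nbd ∧
      proj G ((A.form (q₀, q₁))⁻¹ • q₁) = proj G q₁ := ⟨h.form_mem, proj_smul _ _⟩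
  have h2 : ∃! x : Q, (q₀, x) ∈ A.Hor ∩ A.nbd ∧ proj G x = proj G q₁ := by
    refine ⟨_, h1, ?_⟩
    rintro x ⟨hx, hx'⟩
    obtain ⟨g, rfl⟩ := proj_eq_iff.1 hx'
    rw [← h.eq_form (g := g⁻¹) (by rwa [inv_inv]), inv_inv]
  rw [hlift, dif_pos h2]
  exact h2.unique h2.choose_spec.1 h1

theorem Decomposes.F1_form {A : AffineDiscreteConnection EQ EG G Q} {q₀ q₁ : Q}
    (h : A.Decomposes (q₀, q₁)) : A.F1 q₀ (A.form (q₀, q₁)) (proj G q₁) = q₁ := by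
  rw [F1, h.hlift_proj, smul_inv_smul]

variable {A} in
theorem decomposes_of_mem_domain {p : Q × Q} (h : p ∈ A.domain) : A.Decomposes p :=
  (mem_of_mem_nhds h : p ∈ {p' | A.Decomposes p' ∧ _}).1

variable {A} in
theorem form_smooth {p : Q × Q} (h : p ∈ A.domain) :
    ContMDiffAt (𝓘(ℝ, EQ).prod 𝓘(ℝ, EQ)) 𝓘(ℝ, EG) ∞ A.form p :=
  (mem_of_mem_nhds h : p ∈ {p' | A.Decomposes p' ∧ _}).2

variable {A} in
theorem domain_mem_nhds {p : Q × Q} (h : p ∈ A.domain) : A.domain ∈ 𝓝 p :=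
  eventually_eventually_nhds.2 h

variable [LieGroup 𝓘(ℝ, EG) ∞ G]

variable {A} in
/-- `F̃₁` is smooth around the points of `Q × G × Q/G` over the domain of `𝒜_d`. -/
theorem F1_smooth (hP : IsPrincipalBundle EQ EG EB G Q) {q₀ q₁ : Q} (h : (q₀, q₁) ∈ A.domain)
    (w : G) :
    ContMDiffAt (𝓘(ℝ, EQ).prod (𝓘(ℝ, EG).prod 𝓘(ℝ, EB))) 𝓘(ℝ, EQ) ∞
      (fun x : Q × G × OrbitSpace G Q => A.F1 x.1 x.2.1 x.2.2) (q₀, w, proj G q₁) := by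
  -- With `s` the local section of `π` through `q₁`, near the base point `F̃₁(x, w, r) = (w 𝒜_d(x,
  -- s(r))⁻¹) • s(r)`, which is visibly smooth.
  have hs : ContMDiffAt (𝓘(ℝ, EQ).prod (𝓘(ℝ, EG).prod 𝓘(ℝ, EB))) 𝓘(ℝ, EQ) ∞
      (fun x : Q × G × OrbitSpace G Q => hP.secAt q₁ x.2.2) (q₀, w, proj G q₁) :=
    ((secAt_smooth hP q₁).contMDiffAt (dom_mem_nhds hP _)).comp (q₀, w, proj G q₁)
      (f := fun x : Q × G × OrbitSpace G Q => x.2.2) contMDiffAt_snd.snd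
  have hp : ContMDiffAt (𝓘(ℝ, EQ).prod (𝓘(ℝ, EG).prod 𝓘(ℝ, EB))) (𝓘(ℝ, EQ).prod 𝓘(ℝ, EQ)) ∞
      (fun x : Q × G × OrbitSpace G Q => (x.1, hP.secAt q₁ x.2.2)) (q₀, w, proj G q₁) :=
    contMDiffAt_fst.prodMk hs
  have he : (q₀, hP.secAt q₁ (proj G q₁)) = (q₀, q₁) := by rw [secAt_proj]
  have hf : ContMDiffAt (𝓘(ℝ, EQ).prod (𝓘(ℝ, EG).prod 𝓘(ℝ, EB))) 𝓘(ℝ, EG) ∞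
      (fun x : Q × G × OrbitSpace G Q => A.form (x.1, hP.secAt q₁ x.2.2)) (q₀, w, proj G q₁) :=
    (form_smooth (A := A) (he ▸ h)).comp (q₀, w, proj G q₁) hp
  have hF : ContMDiffAt (𝓘(ℝ, EQ).prod (𝓘(ℝ, EG).prod 𝓘(ℝ, EB))) 𝓘(ℝ, EQ) ∞
      (fun x : Q × G × OrbitSpace G Q =>
        (x.2.1 * (A.form (x.1, hP.secAt q₁ x.2.2))⁻¹) • hP.secAt q₁ x.2.2) (q₀, w, proj G q₁) :=
    (hP.smooth_smul _).comp (q₀, w, proj G q₁) ((contMDiffAt_snd.fst.mul hf.inv).prodMk hs)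
  refine hF.congr_of_eventuallyEq ?_
  have h1 : ∀ᶠ x : Q × G × OrbitSpace G Q in 𝓝 (q₀, w, proj G q₁),
      (x.1, hP.secAt q₁ x.2.2) ∈ A.domain :=
    hp.continuousAt (by simpa only [he] using domain_mem_nhds h)
  have h2 : ∀ᶠ x : Q × G × OrbitSpace G Q in 𝓝 (q₀, w, proj G q₁),
      x.2.2 ∈ hP.dom (proj G q₁) :=
    (continuous_snd.comp continuous_snd).continuousAt (dom_mem_nhds hP (proj G q₁))
  filter_upwards [h1, h2] with x hx1 hx2
  have h3 := (decomposes_of_mem_domain hx1).hlift_proj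
  rw [proj_secAt hP q₁ hx2] at h3
  rw [F1, h3, mul_smul]

end AffineDiscreteConnection

namespace DiscreteSystem

variable {sys : DiscreteSystem EQ Q} {A : AffineDiscreteConnection EQ EG G Q}
variable [LieGroup 𝓘(ℝ, EG) ∞ G]

theorem checkL_form {q₀ q₁ : Q} (h : A.Decomposes (q₀, q₁)) :
    sys.checkL A q₀ (A.form (q₀, q₁)) (proj G q₁) = sys.L (q₀, q₁) := by
  rw [checkL, h.F1_form]

theorem checkL_smul (hS : sys.IsSymmetric G) (g : G) (q₀ : Q) (w : G) (r : OrbitSpace G Q) :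
    sys.checkL A (g • q₀) (g * w * g⁻¹) r = sys.checkL A q₀ w r := by
  rw [checkL, A.F1_smul, hS.L_inv, checkL]

theorem checkL_smooth (hP : IsPrincipalBundle EQ EG EB G Q) {q₀ q₁ : Q}
    (h : (q₀, q₁) ∈ A.domain) (w : G) :
    ContMDiffAt (𝓘(ℝ, EQ).prod (𝓘(ℝ, EG).prod 𝓘(ℝ, EB))) 𝓘(ℝ, ℝ) ∞
      (fun x : Q × G × OrbitSpace G Q => sys.checkL A x.1 x.2.1 x.2.2) (q₀, w, proj G q₁) :=
  (sys.smooth_L _).comp (q₀, w, proj G q₁)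
    (contMDiffAt_fst.prodMk (AffineDiscreteConnection.F1_smooth hP h w))

end DiscreteSystem

end ConnectionForm

/-! ### Equivariance of differentials, partial differentials of `L_d`, and the reduced forces. -/

section Differentials

variable {EQ EG EB : Type*} {G Q : Type*}
  [NormedAddCommGroup EQ] [NormedSpace ℝ EQ] [NormedAddCommGroup EG] [NormedSpace ℝ EG]
  [NormedAddCommGroup EB] [NormedSpace ℝ EB]
  [TopologicalSpace G] [ChartedSpace EG G] [Group G] [LieGroup 𝓘(ℝ, EG) ∞ G]
  [TopologicalSpace Q] [ChartedSpace EQ Q] [IsManifold 𝓘(ℝ, EQ) ∞ Q] [MulAction G Q]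
  [ChartedSpace EB (OrbitSpace G Q)]
  {A : AffineDiscreteConnection EQ EG G Q}

theorem conj_smooth (g : G) :
    ContMDiff 𝓘(ℝ, EG) 𝓘(ℝ, EG) ∞ (fun x : G => g * x * g⁻¹) :=
  (contMDiff_const.mul contMDiff_id).mul contMDiff_const

namespace AffineDiscreteConnection

/-- By equivariance `𝒜_d` near `(g • q₀, g • q₁)` is `𝒜_d` near `(q₀, q₁)` composed with
diffeomorphisms, so existence, uniqueness and smoothness are carried over. -/
theorem smul_mem_domain (hP : IsPrincipalBundle EQ EG EB G Q) {q₀ q₁ : Q}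
    (h : (q₀, q₁) ∈ A.domain) (g : G) : (g • q₀, g • q₁) ∈ A.domain := by
  have hs : ContMDiff (𝓘(ℝ, EQ).prod 𝓘(ℝ, EQ)) (𝓘(ℝ, EQ).prod 𝓘(ℝ, EQ)) ∞
      (fun p : Q × Q => (g⁻¹ • p.1, g⁻¹ • p.2)) :=
    ((smul_smooth hP g⁻¹).comp contMDiff_fst).prodMk ((smul_smooth hP g⁻¹).comp contMDiff_snd)
  have ht : Filter.Tendsto (fun p : Q × Q => (g⁻¹ • p.1, g⁻¹ • p.2)) (𝓝 (g • q₀, g • q₁))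
      (𝓝 (q₀, q₁)) := by
    simpa using (hs.continuous.continuousAt (x := (g • q₀, g • q₁))).tendsto
  refine (ht.eventually h).mono ?_
  rintro ⟨x, y⟩ ⟨h1, h2⟩
  refine ⟨by simpa using h1.smul g, ?_⟩
  have h3 : A.form = (fun x : G => g * x * g⁻¹) ∘ A.form ∘
      (fun p : Q × Q => (g⁻¹ • p.1, g⁻¹ • p.2)) := by
    funext p
    simp [← A.form_smul]
  rw [h3]
  exact (conj_smooth g _).comp _ (ContMDiffAt.comp (x, y) h2 (hs _))

theorem form_left_smooth {q₀ q₁ : Q} (h : (q₀, q₁) ∈ A.domain) :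
    ContMDiffAt 𝓘(ℝ, EQ) 𝓘(ℝ, EG) ∞ (fun x => A.form (x, q₁)) q₀ :=
  (form_smooth h).comp (f := fun x => (x, q₁)) q₀ (contMDiffAt_id.prodMk contMDiffAt_const)

theorem form_right_smooth {q₀ q₁ : Q} (h : (q₀, q₁) ∈ A.domain) :
    ContMDiffAt 𝓘(ℝ, EQ) 𝓘(ℝ, EG) ∞ (fun x => A.form (q₀, x)) q₁ :=
  (form_smooth h).comp (f := fun x => (q₀, x)) q₁ (contMDiffAt_const.prodMk contMDiffAt_id)

/-- Equivariance of `𝒜_d` differentiated in the first variable. The conjugation that appears is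
cancelled by `D2checkL_smul` in the forces. -/
theorem d1form_smul (hP : IsPrincipalBundle EQ EG EB G Q) {q₀ q₁ : Q}
    (h : (q₀, q₁) ∈ A.domain) (g : G) (v : TangentSpace 𝓘(ℝ, EQ) q₀) :
    (A.d1form (g • q₀) (g • q₁) (liftedAction g q₀ v) : EG) =
      mfderiv 𝓘(ℝ, EG) 𝓘(ℝ, EG) (fun x : G => g * x * g⁻¹) (A.form (q₀, q₁))
        (A.d1form q₀ q₁ v) := by
  have h1 := mfderiv_comp_apply q₀
    ((form_left_smooth (smul_mem_domain hP h g)).mdifferentiableAt (by simp))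
    ((smul_smooth hP g).mdifferentiableAt (by simp)) v
  have h2 := mfderiv_comp_apply (g := fun x : G => g * x * g⁻¹) q₀
    ((conj_smooth g).mdifferentiableAt (by simp))
    ((form_left_smooth h).mdifferentiableAt (by simp)) v
  have h3 : ((fun x => A.form (x, g • q₁)) ∘ fun x => g • x) =
      (fun x : G => g * x * g⁻¹) ∘ fun x => A.form (x, q₁) := by
    funext x; exact A.form_smul g x q₁
  rw [h3] at h1
  exact h1.symm.trans h2

theorem d2form_smul (hP : IsPrincipalBundle EQ EG EB G Q) {q₀ q₁ : Q}
    (h : (q₀, q₁) ∈ A.domain) (g : G) (v : TangentSpace 𝓘(ℝ, EQ) q₁) :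
    (A.d2form (g • q₀) (g • q₁) (liftedAction g q₁ v) : EG) =
      mfderiv 𝓘(ℝ, EG) 𝓘(ℝ, EG) (fun x : G => g * x * g⁻¹) (A.form (q₀, q₁))
        (A.d2form q₀ q₁ v) := by
  have h1 := mfderiv_comp_apply q₁
    ((form_right_smooth (smul_mem_domain hP h g)).mdifferentiableAt (by simp))
    ((smul_smooth hP g).mdifferentiableAt (by simp)) v
  have h2 := mfderiv_comp_apply (g := fun x : G => g * x * g⁻¹) q₁
    ((conj_smooth g).mdifferentiableAt (by simp))
    ((form_right_smooth h).mdifferentiableAt (by simp)) v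
  have h3 : ((fun x => A.form (g • q₀, x)) ∘ fun x => g • x) =
      (fun x : G => g * x * g⁻¹) ∘ fun x => A.form (q₀, x) := by
    funext x; exact A.form_smul g q₀ x
  rw [h3] at h1
  exact h1.symm.trans h2

end AffineDiscreteConnection

namespace DiscreteSystem

open AffineDiscreteConnection

variable {sys : DiscreteSystem EQ Q}

theorem checkL_smooth_mid (hP : IsPrincipalBundle EQ EG EB G Q) {q₀ q₁ : Q}
    (h : (q₀, q₁) ∈ A.domain) (w : G) :
    MDifferentiableAt 𝓘(ℝ, EG) 𝓘(ℝ, ℝ) (fun x => sys.checkL A q₀ x (proj G q₁)) w :=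
  ((checkL_smooth hP h w).comp (f := fun x => (q₀, x, proj G q₁)) w
    (contMDiffAt_const.prodMk (contMDiffAt_id.prodMk contMDiffAt_const))).mdifferentiableAt
    (by simp)

/-- Near `q₀`, `L_d(x, q₁) = Ľ_d(x, 𝒜_d(x, q₁), π(q₁))`, where `x` enters the first two slots only.
-/
theorem D1L_apply (hP : IsPrincipalBundle EQ EG EB G Q) {q₀ q₁ : Q}
    (h : (q₀, q₁) ∈ A.domain) (v : TangentSpace 𝓘(ℝ, EQ) q₀) :
    sys.D1L q₀ q₁ v = sys.D1checkL A q₀ (A.form (q₀, q₁)) (proj G q₁) v +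
      sys.D2checkL A q₀ (A.form (q₀, q₁)) (proj G q₁) (A.d1form q₀ q₁ v) := by
  have hc : ContMDiffAt (𝓘(ℝ, EQ).prod 𝓘(ℝ, EG)) 𝓘(ℝ, ℝ) ∞
      (fun x : Q × G => sys.checkL A x.1 x.2 (proj G q₁)) (q₀, A.form (q₀, q₁)) :=
    (checkL_smooth hP h (A.form (q₀, q₁))).comp (f := fun x : Q × G => (x.1, x.2, proj G q₁))
      (q₀, A.form (q₀, q₁))
      (contMDiffAt_fst.prodMk (contMDiffAt_snd.prodMk contMDiffAt_const))
  have h1 := mfderiv_comp₂_apply (a := id) (b := fun x => A.form (x, q₁))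
    (hc.mdifferentiableAt (by simp)) mdifferentiableAt_id
    ((form_left_smooth h).mdifferentiableAt (by simp)) v
  have h2 : (fun x => sys.L (x, q₁)) =ᶠ[𝓝 q₀]
      fun x => sys.checkL A x (A.form (x, q₁)) (proj G q₁) := by
    have : ∀ᶠ x in 𝓝 q₀, (x, q₁) ∈ A.domain :=
      (continuous_id.prodMk continuous_const).continuousAt (domain_mem_nhds h)
    filter_upwards [this] with x hx
    exact (checkL_form (decomposes_of_mem_domain hx)).symm
  rw [mfderiv_id] at h1
  have h3 : sys.D1L q₀ q₁ v = mfderiv 𝓘(ℝ, EQ) 𝓘(ℝ, ℝ)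
      (fun x => sys.checkL A x (A.form (x, q₁)) (proj G q₁)) q₀ v := by
    rw [D1L, dReal, h2.mfderiv_eq]; rfl
  exact h3.trans h1

/-- Near `q₁`, `L_d(q₀, x) = Ľ_d(q₀, 𝒜_d(q₀, x), π(x))`, where `x` enters the last two slots only.
-/
theorem D2L_apply (hP : IsPrincipalBundle EQ EG EB G Q) {q₀ q₁ : Q}
    (h : (q₀, q₁) ∈ A.domain) (v : TangentSpace 𝓘(ℝ, EQ) q₁) :
    sys.D2L q₀ q₁ v = sys.D2checkL A q₀ (A.form (q₀, q₁)) (proj G q₁) (A.d2form q₀ q₁ v) +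
      sys.D3checkL A q₀ (A.form (q₀, q₁)) (proj G q₁) (dproj EQ EB G q₁ v) := by
  have hc : ContMDiffAt (𝓘(ℝ, EG).prod 𝓘(ℝ, EB)) 𝓘(ℝ, ℝ) ∞
      (fun x : G × OrbitSpace G Q => sys.checkL A q₀ x.1 x.2) (A.form (q₀, q₁), proj G q₁) :=
    (checkL_smooth hP h (A.form (q₀, q₁))).comp
      (f := fun x : G × OrbitSpace G Q => (q₀, x.1, x.2)) (A.form (q₀, q₁), proj G q₁)
      (contMDiffAt_const.prodMk (contMDiffAt_fst.prodMk contMDiffAt_snd))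
  have h1 := mfderiv_comp₂_apply (a := fun x => A.form (q₀, x)) (b := proj G)
    (hc.mdifferentiableAt (by simp)) ((form_right_smooth h).mdifferentiableAt (by simp))
    ((proj_smooth hP).mdifferentiableAt (by simp)) v
  have h2 : (fun x => sys.L (q₀, x)) =ᶠ[𝓝 q₁]
      fun x => sys.checkL A q₀ (A.form (q₀, x)) (proj G x) := by
    have : ∀ᶠ x in 𝓝 q₁, (q₀, x) ∈ A.domain :=
      (continuous_const.prodMk continuous_id).continuousAt (domain_mem_nhds h)
    filter_upwards [this] with x hx
    exact (checkL_form (decomposes_of_mem_domain hx)).symm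
  have h3 : sys.D2L q₀ q₁ v = mfderiv 𝓘(ℝ, EQ) 𝓘(ℝ, ℝ)
      (fun x => sys.checkL A q₀ (A.form (q₀, x)) (proj G x)) q₁ v := by
    rw [D2L, dReal, h2.mfderiv_eq]; rfl
  exact h3.trans h1

/-- Moving `q₁` along its orbit changes only the group variable: `L_d(q₀, g • q₁) = Ľ_d(q₀, g w,
π(q₁))` with `w = 𝒜_d(q₀, q₁)`. Differentiate at `g = 1`. -/
theorem D2L_infGen (hP : IsPrincipalBundle EQ EG EB G Q) {q₀ q₁ : Q}
    (h : (q₀, q₁) ∈ A.domain) (ξ : GroupLieAlgebra 𝓘(ℝ, EG) G) :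
    sys.D2L q₀ q₁ (infGen EQ EG G q₁ ξ) =
      covecMulInv (A.form (q₀, q₁)) (sys.D2checkL A q₀ (A.form (q₀, q₁)) (proj G q₁)) ξ := by
  have hL : MDifferentiableAt 𝓘(ℝ, EQ) 𝓘(ℝ, ℝ) (fun x => sys.L (q₀, x)) q₁ :=
    (sys.smooth_L.comp (contMDiff_const.prodMk contMDiff_id)).mdifferentiableAt (by simp)
  have h1 := mfderiv_comp_apply_of_eq (1 : G) hL
    ((orbitMap_smooth hP q₁).mdifferentiableAt (by simp)) (one_smul G q₁) ξ
  have h2 := mfderiv_comp_apply_of_eq (f := fun g : G => g * A.form (q₀, q₁)) (1 : G)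
    (checkL_smooth_mid (sys := sys) hP h (A.form (q₀, q₁)))
    ((contMDiff_mul_right (I := 𝓘(ℝ, EG)) (n := ∞)).mdifferentiableAt (by simp)) (one_mul _) ξ
  have h3 : ((fun x => sys.L (q₀, x)) ∘ fun g : G => g • q₁) =
      (fun x => sys.checkL A q₀ x (proj G q₁)) ∘ fun g : G => g * A.form (q₀, q₁) := by
    funext g
    have hd := decomposes_of_mem_domain h
    simp only [Function.comp]
    rw [← hd.form_smul_right, ← checkL_form (hd.smul_right g), proj_smul]
  rw [h3] at h1
  exact h1.symm.trans h2

/-- Differentiating `L_d(g • q₀, g • q₁) = L_d(q₀, q₁)` at `g = 1` makes the two generator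
derivatives opposite. -/
theorem D1L_infGen (hP : IsPrincipalBundle EQ EG EB G Q) (hS : sys.IsSymmetric G) {q₀ q₁ : Q}
    (h : (q₀, q₁) ∈ A.domain) (ξ : GroupLieAlgebra 𝓘(ℝ, EG) G) :
    sys.D1L q₀ q₁ (infGen EQ EG G q₀ ξ) =
      -covecMulInv (A.form (q₀, q₁)) (sys.D2checkL A q₀ (A.form (q₀, q₁)) (proj G q₁)) ξ := by
  rw [← D2L_infGen hP h, ← add_eq_zero_iff_eq_neg]
  have h1 := mfderiv_comp₂_apply_of_eq (f := sys.L) (a := fun g : G => g • q₀)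
    (b := fun g : G => g • q₁) (x := (1 : G)) (sys.smooth_L.mdifferentiableAt (by simp))
    ((orbitMap_smooth hP q₀).mdifferentiableAt (by simp))
    ((orbitMap_smooth hP q₁).mdifferentiableAt (by simp)) (one_smul G q₀) (one_smul G q₁) ξ
  have h2 : (fun g : G => sys.L (g • q₀, g • q₁)) = fun _ => sys.L (q₀, q₁) := by
    funext g; exact hS.L_inv g q₀ q₁
  rw [h2, mfderiv_const] at h1
  exact h1.symm

theorem D2checkL_smul (hP : IsPrincipalBundle EQ EG EB G Q) (hS : sys.IsSymmetric G) {q₀ q₁ : Q}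
    (h : (q₀, q₁) ∈ A.domain) (g w : G) (η : TangentSpace 𝓘(ℝ, EG) w) :
    sys.D2checkL A (g • q₀) (g * w * g⁻¹) (proj G q₁)
        (mfderiv 𝓘(ℝ, EG) 𝓘(ℝ, EG) (fun x : G => g * x * g⁻¹) w η) =
      sys.D2checkL A q₀ w (proj G q₁) η := by
  have hd := checkL_smooth_mid (sys := sys) hP (smul_mem_domain hP h g) (g * w * g⁻¹)
  rw [proj_smul] at hd
  have h1 := mfderiv_comp_apply w hd ((conj_smooth g).mdifferentiableAt (by simp)) η
  have h2 : ((fun x => sys.checkL A (g • q₀) x (proj G q₁)) ∘ fun x : G => g * x * g⁻¹) =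
      fun x => sys.checkL A q₀ x (proj G q₁) := by
    funext x; exact checkL_smul hS g q₀ x _
  rw [h2] at h1
  exact h1.symm

variable [IsManifold 𝓘(ℝ, EB) ∞ (OrbitSpace G Q)] [FiniteDimensional ℝ EQ]

/-- The force is computed at the representative picked by `rep`, which is `(g • q₀, g w g⁻¹)` for
some `g`. The horizontal lift, `D₁𝒜_d` and `D₂Ľ_d` are all equivariant, and `g` cancels in their
composition. -/
theorem forceMinus_apply (hP : IsPrincipalBundle EQ EG EB G Q) (hS : sys.IsSymmetric G)
    (spl : NonholonomicSplitting EG G sys) {q₀ q₁ : Q}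
    (h : (q₀, q₁) ∈ A.domain) (u : TangentSpace 𝓘(ℝ, EB) (proj G q₀)) :
    forceMinus A hP spl (rho hP (q₀, A.form (q₀, q₁))) (proj G q₁) u =
      sys.D2checkL A q₀ (A.form (q₀, q₁)) (proj G q₁)
        (A.d1form q₀ q₁ (spl.horLift EB q₀ u)) := by
  have key : ∀ (g : G) (p : Q × G), p.1 = g • q₀ → p.2 = g * A.form (q₀, q₁) * g⁻¹ →
      (checkForceMinus EB A spl p.1 p.2 (proj G q₁) : EB →L[ℝ] ℝ) u =
        sys.D2checkL A q₀ (A.form (q₀, q₁)) (proj G q₁)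
          (A.d1form q₀ q₁ (spl.horLift EB q₀ u)) := by
    rintro g ⟨x, y⟩ hx hy
    dsimp only at hx hy
    subst hx hy
    -- The second point attached to the moved representative is `g • q₁`, so every factor is
    -- evaluated along the diagonal translate of `(q₀, q₁)`.
    have hF : A.F1 (g • q₀) (g * A.form (q₀, q₁) * g⁻¹) (proj G q₁) = g • q₁ := by
      rw [A.F1_smul, (decomposes_of_mem_domain h).F1_form]
    have h1 : (checkForceMinus EB A spl (g • q₀) (g * A.form (q₀, q₁) * g⁻¹) (proj G q₁) :
        EB →L[ℝ] ℝ) u = sys.D2checkL A (g • q₀) (g * A.form (q₀, q₁) * g⁻¹) (proj G q₁)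
          (A.d1form (g • q₀) (g • q₁) (spl.horPart EB (g • q₀) (spl.horLift EB (g • q₀) u))) := by
      rw [← hF]; rfl
    refine (h1.trans (congrArg _ ?_)).trans (D2checkL_smul hP hS h g _ _)
    exact (congrArg _ (spl.horPart_horLift_smul hP g q₀ u)).trans (d1form_smul hP h g _)
  obtain ⟨g, h1, h2⟩ := (rho_eq_iff hP).1 (rho_rep hP (rho hP (q₀, A.form (q₀, q₁)))).symm
  exact key g _ h1 h2

theorem forcePlus_apply (hP : IsPrincipalBundle EQ EG EB G Q) (hS : sys.IsSymmetric G)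
    (spl : NonholonomicSplitting EG G sys) {q₀ q₁ : Q}
    (h : (q₀, q₁) ∈ A.domain) (u : TangentSpace 𝓘(ℝ, EB) (proj G q₁)) :
    forcePlus A hP spl (rho hP (q₀, A.form (q₀, q₁))) (proj G q₁) u =
      sys.D2checkL A q₀ (A.form (q₀, q₁)) (proj G q₁)
        (A.d2form q₀ q₁ (spl.horLift EB q₁ u)) := by
  have key : ∀ (g : G) (p : Q × G), p.1 = g • q₀ → p.2 = g * A.form (q₀, q₁) * g⁻¹ →
      (checkForcePlus EB A spl p.1 p.2 (proj G q₁) : EB →L[ℝ] ℝ) u =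
        sys.D2checkL A q₀ (A.form (q₀, q₁)) (proj G q₁)
          (A.d2form q₀ q₁ (spl.horLift EB q₁ u)) := by
    rintro g ⟨x, y⟩ hx hy
    dsimp only at hx hy
    subst hx hy
    have hF : A.F1 (g • q₀) (g * A.form (q₀, q₁) * g⁻¹) (proj G q₁) = g • q₁ := by
      rw [A.F1_smul, (decomposes_of_mem_domain h).F1_form]
    have h1 : (checkForcePlus EB A spl (g • q₀) (g * A.form (q₀, q₁) * g⁻¹) (proj G q₁) :
        EB →L[ℝ] ℝ) u = sys.D2checkL A (g • q₀) (g * A.form (q₀, q₁) * g⁻¹) (proj G q₁)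
          (A.d2form (g • q₀) (g • q₁) (spl.horPart EB (g • q₁) (spl.horLift EB (g • q₁) u))) := by
      rw [← hF]; rfl
    refine (h1.trans (congrArg _ ?_)).trans (D2checkL_smul hP hS h g _ _)
    exact (congrArg _ (spl.horPart_horLift_smul hP g q₁ u)).trans (d2form_smul hP h g _)
  obtain ⟨g, h1, h2⟩ := (rho_eq_iff hP).1 (rho_rep hP (rho hP (q₀, A.form (q₀, q₁)))).symm
  exact key g _ h1 h2

end DiscreteSystem

end Differentials

/-! ### Smoothness of `L̂_d` on `G̃ × Q/G` and its differential. -/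

section ReducedDifferentials

variable {EQ EG EB : Type*} {G Q : Type*}
  [NormedAddCommGroup EQ] [NormedSpace ℝ EQ] [NormedAddCommGroup EG] [NormedSpace ℝ EG]
  [NormedAddCommGroup EB] [NormedSpace ℝ EB]
  [TopologicalSpace G] [ChartedSpace EG G] [Group G] [LieGroup 𝓘(ℝ, EG) ∞ G]
  [TopologicalSpace Q] [ChartedSpace EQ Q] [IsManifold 𝓘(ℝ, EQ) ∞ Q] [MulAction G Q]
  [ChartedSpace EB (OrbitSpace G Q)] [IsManifold 𝓘(ℝ, EB) ∞ (OrbitSpace G Q)]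
  {A : AffineDiscreteConnection EQ EG G Q}

/-- The local trivializations of `G̃` are smooth. -/
theorem conjTriv_smooth (hP : IsPrincipalBundle EQ EG EB G Q) {r : OrbitSpace G Q}
    {v : ConjBundle hP} (hv : v.base hP ∈ hP.dom r) :
    ContMDiffAt (𝓘(ℝ, EB).prod 𝓘(ℝ, EG)) (𝓘(ℝ, EB).prod 𝓘(ℝ, EG)) ∞ (conjTriv hP r) v := by
  set ψ := chartAt (ModelProd EB EG) (conjTriv hP r v) with hψ
  have hmem : conjTriv hP r ≫ₕ ψ ∈ atlas (ModelProd EB EG) (ConjBundle hP) :=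
    ⟨r, ψ, chart_mem_atlas _ _, rfl⟩
  have hv' : v ∈ (conjTriv hP r).source := hv
  have hs : v ∈ (conjTriv hP r ≫ₕ ψ).source := by
    rw [OpenPartialHomeomorph.trans_source]
    exact ⟨hv', mem_chart_source (ModelProd EB EG) (conjTriv hP r v)⟩
  have h1 : ContMDiffAt (𝓘(ℝ, EB).prod 𝓘(ℝ, EG)) (𝓘(ℝ, EB).prod 𝓘(ℝ, EG)) ∞
      (conjTriv hP r ≫ₕ ψ) v :=
    (contMDiffOn_of_mem_maximalAtlas (I := 𝓘(ℝ, EB).prod 𝓘(ℝ, EG)) (n := ∞)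
      (IsManifold.subset_maximalAtlas hmem)).contMDiffAt
      ((conjTriv hP r ≫ₕ ψ).open_source.mem_nhds hs)
  have h2 : ContMDiffAt (𝓘(ℝ, EB).prod 𝓘(ℝ, EG)) (𝓘(ℝ, EB).prod 𝓘(ℝ, EG)) ∞
      ψ.symm ((conjTriv hP r ≫ₕ ψ) v) :=
    (contMDiffOn_symm_of_mem_maximalAtlas (I := 𝓘(ℝ, EB).prod 𝓘(ℝ, EG)) (n := ∞)
      (IsManifold.chart_mem_maximalAtlas _)).contMDiffAt
      (ψ.open_target.mem_nhds (ψ.map_source (mem_chart_source (ModelProd EB EG) _)))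
  -- Near `v`, the trivialization is `ψ⁻¹` after the map `conjTriv hP r ≫ₕ ψ`, and the latter is a
  -- chart of `G̃`.
  refine (h2.comp v h1).congr_of_eventuallyEq ?_
  filter_upwards [(conjTriv hP r ≫ₕ ψ).open_source.mem_nhds hs] with x hx
  rw [OpenPartialHomeomorph.trans_source] at hx
  exact (ψ.left_inv hx.2).symm

/-- Around each of its values, `ρ` has a smooth local section through any given preimage. -/
theorem exists_rho_section (hP : IsPrincipalBundle EQ EG EB G Q) (q : Q) (w : G) :
    ∃ σ : ConjBundle hP → Q × G, σ (rho hP (q, w)) = (q, w) ∧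
      ContMDiffAt (𝓘(ℝ, EB).prod 𝓘(ℝ, EG)) (𝓘(ℝ, EQ).prod 𝓘(ℝ, EG)) ∞ σ (rho hP (q, w)) ∧
      ∀ᶠ v in 𝓝 (rho hP (q, w)), rho hP (σ v) = v := by
  set r := proj G q
  set g := (hP.triv r q).2 with hg
  have hr : proj G q ∈ hP.dom r := mem_dom hP _
  have hb : rho hP (q, w) ∈ (conjTriv hP r).source := hr
  have hv : conjTriv hP r (rho hP (q, w)) = (r, g⁻¹ * w * g) :=
    (preConjChart_eq hP (rho_rep hP _).symm hr).symm
  -- The inverse of the trivialization lifts to `(x, w') ↦ (s(x), w')`. Acting with `g = τ(q)`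
  -- leaves the image under `ρ` unchanged and makes the section pass through `(q, w)`.
  refine ⟨fun v => (hP.secAt q (conjTriv hP r v).1, g * (conjTriv hP r v).2 * g⁻¹), ?_, ?_, ?_⟩
  · dsimp only
    rw [hv]
    refine Prod.ext (secAt_proj hP q) ?_
    simp [mul_assoc]
  · have ht := conjTriv_smooth hP (r := r) (v := rho hP (q, w)) hr
    have hs : ContMDiffAt 𝓘(ℝ, EB) 𝓘(ℝ, EQ) ∞ (hP.secAt q)
        (conjTriv hP r (rho hP (q, w))).1 := by
      rw [hv]
      exact (secAt_smooth hP q).contMDiffAt (dom_mem_nhds hP _)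
    exact (ContMDiffAt.comp (rho hP (q, w)) hs ht.fst).prodMk
      ((conj_smooth g).contMDiffAt.comp (rho hP (q, w)) ht.snd)
  · filter_upwards [(conjTriv hP r).open_source.mem_nhds hb] with v hv'
    refine (rho_conj hP g _ _).trans ?_
    exact (conjTriv hP r).left_inv hv'

namespace DiscreteSystem

open AffineDiscreteConnection

variable {sys : DiscreteSystem EQ Q}

/-- Locally `L̂_d` is `Ľ_d` composed with a smooth section of `ρ`. -/
theorem hatL_smooth (hP : IsPrincipalBundle EQ EG EB G Q) (hS : sys.IsSymmetric G) {q₀ q₁ : Q}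
    (h : (q₀, q₁) ∈ A.domain) (w : G) :
    ContMDiffAt ((𝓘(ℝ, EB).prod 𝓘(ℝ, EG)).prod 𝓘(ℝ, EB)) 𝓘(ℝ, ℝ) ∞
      (fun x : ConjBundle hP × OrbitSpace G Q => hatL A hP hS x.1 x.2)
      (rho hP (q₀, w), proj G q₁) := by
  obtain ⟨σ, h1, h2, h3⟩ := exists_rho_section hP q₀ w
  have h4 : ContMDiffAt ((𝓘(ℝ, EB).prod 𝓘(ℝ, EG)).prod 𝓘(ℝ, EB)) (𝓘(ℝ, EQ).prod 𝓘(ℝ, EG)) ∞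
      (fun x : ConjBundle hP × OrbitSpace G Q => σ x.1) (rho hP (q₀, w), proj G q₁) :=
    h2.comp (f := Prod.fst) (rho hP (q₀, w), proj G q₁) contMDiffAt_fst
  have h5 : ContMDiffAt (𝓘(ℝ, EQ).prod (𝓘(ℝ, EG).prod 𝓘(ℝ, EB))) 𝓘(ℝ, ℝ) ∞
      (fun x : Q × G × OrbitSpace G Q => sys.checkL A x.1 x.2.1 x.2.2)
      ((σ (rho hP (q₀, w))).1, (σ (rho hP (q₀, w))).2, proj G q₁) := by
    rw [h1]; exact checkL_smooth hP h w
  refine (h5.comp (f := fun x : ConjBundle hP × OrbitSpace G Q => ((σ x.1).1, (σ x.1).2, x.2))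
    (rho hP (q₀, w), proj G q₁)
    (h4.fst.prodMk (h4.snd.prodMk contMDiffAt_snd))).congr_of_eventuallyEq ?_
  have h6 : ∀ᶠ x : ConjBundle hP × OrbitSpace G Q in 𝓝 (rho hP (q₀, w), proj G q₁),
      rho hP (σ x.1) = x.1 := 
    Filter.Tendsto.eventually (f := Prod.fst) (continuous_fst.tendsto (rho hP (q₀, w), proj G q₁)) h3
  filter_upwards [h6] with x hx
  conv_lhs => rw [← hx]
  rfl

theorem hatL_Upsilon (hP : IsPrincipalBundle EQ EG EB G Q) (hS : sys.IsSymmetric G) {q₀ q₁ : Q}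
    (h : A.Decomposes (q₀, q₁)) :
    hatL A hP hS (rho hP (q₀, A.form (q₀, q₁))) (proj G q₁) = sys.L (q₀, q₁) :=
  checkL_form h

/-- The differential of `L_d` factors through the differential of `L̂_d`. -/
theorem dReal_hatL_apply (hP : IsPrincipalBundle EQ EG EB G Q) (hS : sys.IsSymmetric G)
    {q₀ q₁ : Q} (h : (q₀, q₁) ∈ A.domain) (δ₀ : TangentSpace 𝓘(ℝ, EQ) q₀)
    (δ₁ : TangentSpace 𝓘(ℝ, EQ) q₁) :
    dReal ((𝓘(ℝ, EB).prod 𝓘(ℝ, EG)).prod 𝓘(ℝ, EB))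
        (fun x : ConjBundle hP × OrbitSpace G Q => hatL A hP hS x.1 x.2)
        (rho hP (q₀, A.form (q₀, q₁)), proj G q₁)
        (drho hP q₀ (A.form (q₀, q₁)) δ₀ (A.dform (q₀, q₁) δ₀ δ₁), dproj EQ EB G q₁ δ₁) =
      sys.D1L q₀ q₁ δ₀ + sys.D2L q₀ q₁ δ₁ := by
  have hA : MDifferentiableAt (𝓘(ℝ, EQ).prod 𝓘(ℝ, EQ)) 𝓘(ℝ, EG) A.form (q₀, q₁) :=
    (form_smooth h).mdifferentiableAt (by simp)
  have hr : MDifferentiableAt (𝓘(ℝ, EQ).prod 𝓘(ℝ, EG)) (𝓘(ℝ, EB).prod 𝓘(ℝ, EG)) (rho hP)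
      (q₀, A.form (q₀, q₁)) := (rho_smooth hP).mdifferentiableAt (by simp)
  have hp : MDifferentiableAt 𝓘(ℝ, EQ) 𝓘(ℝ, EB) (proj G : Q → OrbitSpace G Q) q₁ :=
    (proj_smooth hP).mdifferentiableAt (by simp)
  have hL : MDifferentiableAt ((𝓘(ℝ, EB).prod 𝓘(ℝ, EG)).prod 𝓘(ℝ, EB)) 𝓘(ℝ, ℝ)
      (fun x : ConjBundle hP × OrbitSpace G Q => hatL A hP hS x.1 x.2)
      (rho hP (q₀, A.form (q₀, q₁)), proj G q₁) :=
    (hatL_smooth hP hS h _).mdifferentiableAt (by simp)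
  have h1 : HasMFDerivAt (𝓘(ℝ, EQ).prod 𝓘(ℝ, EQ)) (𝓘(ℝ, EQ).prod 𝓘(ℝ, EG))
      (fun p : Q × Q => (p.1, A.form p)) (q₀, q₁) _ :=
    (hasMFDerivAt_fst (q₀, q₁)).prodMk hA.hasMFDerivAt
  have h2 : HasMFDerivAt (𝓘(ℝ, EQ).prod 𝓘(ℝ, EQ)) 𝓘(ℝ, EB)
      (fun p : Q × Q => (proj G p.2 : OrbitSpace G Q)) (q₀, q₁) _ :=
    hp.hasMFDerivAt.comp (q₀, q₁) (hasMFDerivAt_snd (q₀, q₁))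
  have h3 := (hr.hasMFDerivAt.comp (q₀, q₁) h1).prodMk h2
  have h4 := hL.hasMFDerivAt.comp (q₀, q₁) h3
  -- The factorization `L_d = L̂_d ∘ Υ` holds on the neighbourhood `A.domain` of the point, which
  -- suffices for differentials.
  have h5 : sys.L =ᶠ[𝓝 (q₀, q₁)] fun p : Q × Q =>
      hatL A hP hS (rho hP (p.1, A.form p)) (proj G p.2) := by
    filter_upwards [domain_mem_nhds h] with p hp
    exact (hatL_Upsilon hP hS (decomposes_of_mem_domain hp)).symm
  have h6 := (h4.congr_of_eventuallyEq h5).mfderiv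
  have h7 := mfderiv_prod_eq_add_apply (I := 𝓘(ℝ, EQ)) (I' := 𝓘(ℝ, EQ)) (f := sys.L)
    (p := (q₀, q₁)) (v := (δ₀, δ₁))
    (sys.smooth_L.mdifferentiableAt (by simp))
  exact (DFunLike.congr_fun h6 (δ₀, δ₁)).symm.trans h7

theorem drho_add (hP : IsPrincipalBundle EQ EG EB G Q) (q : Q) (w : G)
    (δ δ' : TangentSpace 𝓘(ℝ, EQ) q) (η η' : TangentSpace 𝓘(ℝ, EG) w) :
    drho hP q w (δ + δ') (η + η') = drho hP q w δ η + drho hP q w δ' η' :=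
  map_add (mfderiv (𝓘(ℝ, EQ).prod 𝓘(ℝ, EG)) (𝓘(ℝ, EB).prod 𝓘(ℝ, EG)) (rho hP) (q, w))
    (δ, η) (δ', η')

theorem dform_add (p : Q × Q) (δ₀ δ₀' : TangentSpace 𝓘(ℝ, EQ) p.1)
    (δ₁ δ₁' : TangentSpace 𝓘(ℝ, EQ) p.2) :
    A.dform p (δ₀ + δ₀') (δ₁ + δ₁') = A.dform p δ₀ δ₁ + A.dform p δ₀' δ₁' :=
  map_add (mfderiv (𝓘(ℝ, EQ).prod 𝓘(ℝ, EQ)) 𝓘(ℝ, EG) A.form p) (δ₀, δ₁) (δ₀', δ₁')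

end DiscreteSystem

end ReducedDifferentials

/-! ### The variational principles, the equations and their equivalences. -/

section Equivalences

variable {EQ EG EB : Type*} {G Q : Type*}
  [NormedAddCommGroup EQ] [NormedSpace ℝ EQ] [NormedAddCommGroup EG] [NormedSpace ℝ EG]
  [NormedAddCommGroup EB] [NormedSpace ℝ EB]
  [TopologicalSpace G] [ChartedSpace EG G] [Group G] [LieGroup 𝓘(ℝ, EG) ∞ G]
  [TopologicalSpace Q] [ChartedSpace EQ Q] [IsManifold 𝓘(ℝ, EQ) ∞ Q] [MulAction G Q]
  [ChartedSpace EB (OrbitSpace G Q)] [IsManifold 𝓘(ℝ, EB) ∞ (OrbitSpace G Q)]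
  {A : AffineDiscreteConnection EQ EG G Q} {sys : DiscreteSystem EQ Q} {N : ℕ}

namespace DiscreteSystem

open AffineDiscreteConnection

theorem dReal_action (q : Fin (N + 1) → Q) (δ : ∀ k, TangentSpace 𝓘(ℝ, EQ) (q k)) :
    dReal (ModelWithCorners.pi fun _ : Fin (N + 1) => 𝓘(ℝ, EQ)) sys.action q δ =
      ∑ k : Fin N, (sys.D1L (q k.castSucc) (q k.succ) (δ k.castSucc) +
        sys.D2L (q k.castSucc) (q k.succ) (δ k.succ)) := by
  have h := dReal_sum_comp (I := ModelWithCorners.pi fun _ : Fin (N + 1) => 𝓘(ℝ, EQ))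
    (f := fun _ : Fin N => sys.L)
    (e := fun k (x : Fin (N + 1) → Q) => (x k.castSucc, x k.succ)) (p := q)
    (fun k => sys.smooth_L.mdifferentiableAt (by simp))
    (fun k => (hasMFDerivAt_eval (I := 𝓘(ℝ, EQ)) q k.castSucc).prodMk
      (hasMFDerivAt_eval (I := 𝓘(ℝ, EQ)) q k.succ)) δ
  refine h.trans (Finset.sum_congr rfl fun k _ => ?_)
  exact mfderiv_prod_eq_add_apply (I := 𝓘(ℝ, EQ)) (I' := 𝓘(ℝ, EQ)) (f := sys.L)
    (p := (q k.castSucc, q k.succ))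
    (v := (δ k.castSucc, δ k.succ)) (sys.smooth_L.mdifferentiableAt (by simp))

/-- Discrete integration by parts. -/
theorem dReal_action_succ {M : ℕ} (q : Fin (M + 1 + 1) → Q)
    (δ : ∀ k, TangentSpace 𝓘(ℝ, EQ) (q k)) (h0 : δ 0 = 0) (hN : δ (Fin.last (M + 1)) = 0) :
    dReal (ModelWithCorners.pi fun _ : Fin (M + 1 + 1) => 𝓘(ℝ, EQ)) sys.action q δ =
      ∑ i : Fin M, (sys.D1L (q i.succ.castSucc) (q i.succ.succ) +
        sys.D2L (q i.castSucc.castSucc) (q i.succ.castSucc)) (δ i.succ.castSucc) := by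
  -- The `k = 0` term leaves the `D₁` sum and the last term leaves the `D₂` sum: these are the
  -- boundary terms. What remains of both sums is indexed by the interior node `i + 1`.
  rw [dReal_action, Finset.sum_add_distrib, Fin.sum_univ_succ, Fin.sum_univ_castSucc (n := M)]
  have h1 : sys.D1L (q (0 : Fin (M + 1)).castSucc) (q (0 : Fin (M + 1)).succ)
      (δ (0 : Fin (M + 1)).castSucc) = 0 := by
    refine (congrArg _ (show δ (0 : Fin (M + 1)).castSucc = 0 from h0)).trans (map_zero _)
  have h2 : sys.D2L (q (Fin.last M).castSucc) (q (Fin.last M).succ) (δ (Fin.last M).succ) = 0 := by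
    refine (congrArg _ (show δ (Fin.last M).succ = 0 from hN)).trans (map_zero _)
  rw [h1, h2, zero_add, add_zero, ← Finset.sum_add_distrib]
  rfl

/-- After summation by parts the interior values of `δq` are independent, so the sum vanishes for
all of them exactly when each summand does. -/
theorem variationalPrinciple_iff_equations (q : Fin (N + 1) → Q) :
    sys.VariationalPrinciple q ↔ sys.Equations q := by
  refine and_congr_right fun _ => ?_
  cases N with
  | zero =>
    refine ⟨fun _ j => j.elim0, fun _ δ _ _ _ => ?_⟩
    rw [dReal_action]; simp
  | succ M =>
    constructor
    · intro h j k hjk v hv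
      -- The condition `j + 1 = k` excludes `k = 0`, so the interior nodes are exactly those with `k
      -- = i + 1` and `j = i`.
      obtain ⟨i, rfl⟩ : ∃ i : Fin M, k = i.succ := by
        refine ⟨k.pred ?_, (Fin.succ_pred _ _).symm⟩
        rintro rfl
        exact Fin.succ_ne_zero j hjk
      obtain rfl : j = i.castSucc := by
        apply Fin.succ_injective
        rw [hjk]; rfl
      classical
      -- Test variation supported at the single interior node `i + 1`.
      have h1 := h (Function.update (fun _ => 0) i.succ.castSucc v)
        (Function.update_of_ne (by simp [Fin.ext_iff]) _ _)
        (Function.update_of_ne (by simp [Fin.ext_iff]; omega) _ _) (fun k => by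
          by_cases hk : k = i.succ.castSucc
          · subst hk; simpa using hv
          · rw [Function.update_of_ne hk]; exact zero_mem _)
      rw [dReal_action_succ _ _ (Function.update_of_ne (by simp [Fin.ext_iff]) _ _)
        (Function.update_of_ne (by simp [Fin.ext_iff]; omega) _ _), Finset.sum_eq_single i] at h1
      · rwa [Function.update_self] at h1
      · intro i' _ hi'
        rw [Function.update_of_ne (by simpa [Fin.ext_iff] using hi')]
        exact map_zero _
      · simp
    · intro h δ h0 hN hδ
      rw [dReal_action_succ _ _ h0 hN]
      exact Finset.sum_eq_zero fun i _ => h i.castSucc i.succ rfl _ (hδ _)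

variable (hP : IsPrincipalBundle EQ EG EB G Q) (hS : sys.IsSymmetric G)
  (spl : NonholonomicSplitting EG G sys)

include hS in
-- If two pairs of the domain have the same image under `Υ`, their first components and group
-- elements differ by the action of some `g`; since `F̃₁` is equivariant and recovers the second
-- component, the pairs differ by the diagonal action of `g`, under which `𝒟_d` is invariant.
theorem mem_hatDd_iff {q₀ q₁ : Q} (h : (q₀, q₁) ∈ A.domain) :
    (rho hP (q₀, A.form (q₀, q₁)), proj G q₁) ∈ hatDd sys A hP ↔ (q₀, q₁) ∈ sys.Dd := by
  refine ⟨?_, fun hd => ⟨(q₀, q₁), ⟨hd, h⟩, rfl⟩⟩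
  rintro ⟨⟨x₀, x₁⟩, ⟨hd, hx⟩, he⟩
  obtain ⟨he1, he2⟩ := Prod.ext_iff.1 he
  obtain ⟨g, h1, h2⟩ := (rho_eq_iff hP).1 he1
  dsimp only at h1 h2
  have h3 : q₁ = g • x₁ := by
    have he2' : proj G x₁ = proj G q₁ := he2
    rw [← (decomposes_of_mem_domain h).F1_form, h2, ← he2', h1, A.F1_smul,
      (decomposes_of_mem_domain hx).F1_form]
  rw [h1, h3]
  exact hS.Dd_inv g _ _ hd

theorem dReal_hatAction {q : Fin (N + 1) → Q}
    (hq : ∀ k : Fin N, (q k.castSucc, q k.succ) ∈ A.domain)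
    (δv : ∀ k : Fin N, TangentSpace (𝓘(ℝ, EB).prod 𝓘(ℝ, EG)) (vCurve hP A q k))
    (δr : ∀ k, TangentSpace 𝓘(ℝ, EB) (rCurve G q k)) :
    dReal ((ModelWithCorners.pi fun _ : Fin N => 𝓘(ℝ, EB).prod 𝓘(ℝ, EG)).prod
        (ModelWithCorners.pi fun _ : Fin (N + 1) => 𝓘(ℝ, EB)))
      (hatAction hP A hS) (vCurve hP A q, rCurve G q) (δv, δr) =
    ∑ k : Fin N, dReal ((𝓘(ℝ, EB).prod 𝓘(ℝ, EG)).prod 𝓘(ℝ, EB))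
        (fun x : ConjBundle hP × OrbitSpace G Q => hatL A hP hS x.1 x.2)
        (vCurve hP A q k, rCurve G q k.succ) (δv k, δr k.succ) := by
  exact dReal_sum_comp
    (I := (ModelWithCorners.pi fun _ : Fin N => 𝓘(ℝ, EB).prod 𝓘(ℝ, EG)).prod
        (ModelWithCorners.pi fun _ : Fin (N + 1) => 𝓘(ℝ, EB)))
    (f := fun _ : Fin N => fun x : ConjBundle hP × OrbitSpace G Q => hatL A hP hS x.1 x.2)
    (e := fun k (c : (Fin N → ConjBundle hP) × (Fin (N + 1) → OrbitSpace G Q)) =>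
      (c.1 k, c.2 k.succ)) (p := (vCurve hP A q, rCurve G q))
    (fun k => (hatL_smooth hP hS (hq k) _).mdifferentiableAt (by simp))
    (fun k => ((hasMFDerivAt_eval (I := 𝓘(ℝ, EB).prod 𝓘(ℝ, EG)) (vCurve hP A q) k).comp
        (vCurve hP A q, rCurve G q) (hasMFDerivAt_fst (vCurve hP A q, rCurve G q))).prodMk
      ((hasMFDerivAt_eval (I := 𝓘(ℝ, EB)) (rCurve G q) k.succ).comp
        (vCurve hP A q, rCurve G q) (hasMFDerivAt_snd (vCurve hP A q, rCurve G q)))) (δv, δr)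

variable [FiniteDimensional ℝ EQ]

/-- The reduced action differentiates along `(δv_·, δr_·)` as the action does along
`δq_k = h^{q_k}(δr_k) + (ξ_k)_Q(q_k)`. -/
theorem dReal_hatAction_deltaV {q : Fin (N + 1) → Q}
    (hq : ∀ k : Fin N, (q k.castSucc, q k.succ) ∈ A.domain)
    (δr : ∀ k, TangentSpace 𝓘(ℝ, EB) (rCurve G q k))
    (ξ : Fin (N + 1) → GroupLieAlgebra 𝓘(ℝ, EG) G) :
    dReal ((ModelWithCorners.pi fun _ : Fin N => 𝓘(ℝ, EB).prod 𝓘(ℝ, EG)).prod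
        (ModelWithCorners.pi fun _ : Fin (N + 1) => 𝓘(ℝ, EB)))
      (hatAction hP A hS) (vCurve hP A q, rCurve G q) (deltaV hP spl A q δr ξ, δr) =
    dReal (ModelWithCorners.pi fun _ : Fin (N + 1) => 𝓘(ℝ, EQ)) sys.action q
      (fun k => spl.horLift EB (q k) (δr k) + infGen EQ EG G (q k) (ξ k)) := by
  rw [dReal_hatAction hP hS hq, dReal_action]
  refine Finset.sum_congr rfl fun k _ => ?_
  refine Eq.trans ?_ (dReal_hatL_apply hP hS (hq k) _ _)
  -- The two summands of `δv_k` recombine into the single image of `δq_k` and `δq_{k+1}`; the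
  -- generator part of `δq_{k+1}` is invisible to `dπ`.
  rw [dform_add, drho_add]
  have h : dproj EQ EB G (q k.succ) (spl.horLift EB (q k.succ) (δr k.succ) +
      infGen EQ EG G (q k.succ) (ξ k.succ)) = δr k.succ := by
    rw [map_add, dproj_infGen hP, add_zero]
    exact spl.dproj_horLift hP _ _
  rw [h]
  rfl

/-- Admissible `(δr, ξ)` give admissible `δq = h(δr) + ξ_Q`, and each admissible `δq` arises this
way; the two actions have equal differentials along matching variations. -/
theorem variationalPrinciple_iff_reduced {q : Fin (N + 1) → Q}
    (hq : ∀ k : Fin N, (q k.castSucc, q k.succ) ∈ A.domain) :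
    sys.VariationalPrinciple q ↔ ReducedVariationalPrinciple hP spl A hS q := by
  refine and_congr (forall_congr' fun k => (mem_hatDd_iff hP hS (hq k)).symm) ?_
  constructor
  · intro h δr ξ hr0 hrN hξ0 hξN hr hξ
    rw [dReal_hatAction_deltaV hP hS spl hq]
    refine h _ ?_ ?_ fun k => add_mem (spl.horLift_mem_D hP (hr k)) (hξ k)
    · rw [hr0, hξ0]
      exact (congrArg₂ (· + ·) (map_zero _) (map_zero _)).trans (add_zero _)
    · rw [hrN, hξN]
      exact (congrArg₂ (· + ·) (map_zero _) (map_zero _)).trans (add_zero _)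
  · intro h δ h0 hN hδ
    -- `exists_decomposition` does not record that `ξ = 0` when `δ k = 0`, which the fixed end
    -- points require; the value `0` is therefore chosen by hand in that case.
    have hex : ∀ k, ∃ ξ ∈ gD EG G sys (q k), (δ k = 0 → ξ = 0) ∧
        δ k = spl.horLift EB (q k) (dproj EQ EB G (q k) (δ k)) + infGen EQ EG G (q k) ξ := by
      intro k
      by_cases hk : δ k = 0
      · refine ⟨0, zero_mem _, fun _ => rfl, ?_⟩
        rw [hk, map_zero, map_zero, map_zero, add_zero]
      · obtain ⟨ξ, h1, h2⟩ := spl.exists_decomposition hP (hδ k)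
        exact ⟨ξ, h1, fun h' => absurd h' hk, h2⟩
    choose ξ hξ hξ0 hdec using hex
    have h1 := h (fun k => dproj EQ EB G (q k) (δ k)) ξ
      ((congrArg _ h0).trans (map_zero _)) ((congrArg _ hN).trans (map_zero _))
      (hξ0 _ h0) (hξ0 _ hN) (fun k => ⟨δ k, hδ k, rfl⟩) hξ
    exact (congrArg _ (funext hdec)).trans
      ((dReal_hatAction_deltaV hP hS spl hq (fun k => dproj EQ EB G (q k) (δ k)) ξ).symm.trans h1)

include hS in
-- Adding `D1L_apply` at `(q_k, q_{k+1})` and `D2L_apply` at `(q_{k-1}, q_k)` on a horizontal lift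
-- gives the four terms of `φ`: those passing through `𝒜_d` are the forces, and `dπ` undoes the lift
-- in the `D₃` term.
theorem phi_apply {q : Fin (N + 1) → Q}
    (hq : ∀ k : Fin N, (q k.castSucc, q k.succ) ∈ A.domain) (j k : Fin N)
    (hjk : j.succ = k.castSucc) (u : TangentSpace 𝓘(ℝ, EB) (rCurve G q k.castSucc)) :
    phi hP spl A q j k u = (sys.D1L (q k.castSucc) (q k.succ) +
      sys.D2L (q j.castSucc) (q k.castSucc)) (spl.horLift EB (q k.castSucc) u) := by
  have hj := hq j
  -- `wCurve A q j` is built from `q j.succ`, which equals `q k.castSucc` only through `hjk`.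
  have hw : wCurve A q j = A.form (q j.castSucc, q k.castSucc) := by rw [← hjk]; rfl
  rw [hjk] at hj
  have h1 := (D1L_apply (sys := sys) hP (hq k) (spl.horLift EB (q k.castSucc) u)).trans
    (congrArg _ (forceMinus_apply hP hS spl (hq k) u).symm)
  have h2 := (D2L_apply (sys := sys) hP hj (spl.horLift EB (q k.castSucc) u)).trans
    (congrArg₂ (· + ·) (forcePlus_apply hP hS spl hj u).symm
      (congrArg _ (spl.dproj_horLift hP (q k.castSucc) u)))
  have h3 : phi hP spl A q j k u =
      sys.D1checkL A (q k.castSucc) (A.form (q k.castSucc, q k.succ)) (proj G (q k.succ))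
        (spl.horLift EB (q k.castSucc) u) +
      sys.D3checkL A (q j.castSucc) (A.form (q j.castSucc, q k.castSucc)) (proj G (q k.castSucc)) u +
      forceMinus A hP spl (rho hP (q k.castSucc, A.form (q k.castSucc, q k.succ)))
        (proj G (q k.succ)) u +
      forcePlus A hP spl (rho hP (q j.castSucc, A.form (q j.castSucc, q k.castSucc)))
        (proj G (q k.castSucc)) u := by
    rw [← hw]; rfl
  rw [h3, add_apply, h1, h2]
  ring

include hP hS in
-- Both terms of `ψ` are derivatives of `L_d` along the generator at `q_k`: as second point of
-- `(q_{k-1}, q_k)`, and with a minus sign as first point of `(q_k, q_{k+1})`.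
theorem psi_apply {q : Fin (N + 1) → Q}
    (hq : ∀ k : Fin N, (q k.castSucc, q k.succ) ∈ A.domain) (j k : Fin N)
    (hjk : j.succ = k.castSucc) (ξ : GroupLieAlgebra 𝓘(ℝ, EG) G) :
    psi sys A q j k ξ = (sys.D1L (q k.castSucc) (q k.succ) +
      sys.D2L (q j.castSucc) (q k.castSucc)) (infGen EQ EG G (q k.castSucc) ξ) := by
  have hj := hq j
  have hw : wCurve A q j = A.form (q j.castSucc, q k.castSucc) := by rw [← hjk]; rfl
  rw [hjk] at hj
  rw [add_apply, D1L_infGen hP hS (hq k), D2L_infGen hP hj, neg_add_eq_sub, psi, hw]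
  rfl

include hS in
-- `𝒟_{q_k}` is spanned by the lifts of `𝒟̂_{r_k}` and the generators of `𝔤^𝒟_{q_k}`, so a covector
-- vanishes on it exactly when it vanishes on both families.
theorem equations_iff_reduced {q : Fin (N + 1) → Q}
    (hq : ∀ k : Fin N, (q k.castSucc, q k.succ) ∈ A.domain) :
    sys.Equations q ↔ ReducedEquations hP spl A q := by
  refine and_congr (forall_congr' fun k => (mem_hatDd_iff hP hS (hq k)).symm) ?_
  refine forall_congr' fun j => forall_congr' fun k => forall_congr' fun hjk => ?_
  constructor
  · intro h
    refine ⟨fun u hu => ?_, fun ξ hξ => ?_⟩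
    · exact (phi_apply hP hS spl hq j k hjk u).trans (h _ (spl.horLift_mem_D hP hu))
    · rw [psi_apply hP hS hq j k hjk]
      exact h _ hξ
  · rintro ⟨h1, h2⟩ v hv
    obtain ⟨ξ, hξ, hd⟩ := spl.exists_decomposition hP hv
    have h3 := (phi_apply hP hS spl hq j k hjk (dproj EQ EB G _ v)).symm.trans
      (h1 _ ⟨v, hv, rfl⟩)
    have h4 := h2 ξ hξ
    rw [psi_apply hP hS hq j k hjk] at h4
    rw [hd, map_add]
    exact (congrArg₂ (· + ·) h3 h4).trans (add_zero _)

end DiscreteSystem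

end Equivalences

end DiscreteMechanics

end

open DiscreteMechanics in
theorem mainTheorem1 {EQ EG EB : Type*} {G Q : Type*}
    [NormedAddCommGroup EQ] [NormedSpace ℝ EQ] [FiniteDimensional ℝ EQ]
    [NormedAddCommGroup EG] [NormedSpace ℝ EG] [FiniteDimensional ℝ EG]
    [NormedAddCommGroup EB] [NormedSpace ℝ EB] [FiniteDimensional ℝ EB]
    [TopologicalSpace G] [ChartedSpace EG G] [Group G] [LieGroup 𝓘(ℝ, EG) ∞ G]
    [TopologicalSpace Q] [ChartedSpace EQ Q] [IsManifold 𝓘(ℝ, EQ) ∞ Q] [MulAction G Q]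
    [ChartedSpace EB (OrbitSpace G Q)] [IsManifold 𝓘(ℝ, EB) ∞ (OrbitSpace G Q)]
    (hP : IsPrincipalBundle EQ EG EB G Q)
    (sys : DiscreteSystem EQ Q) (hS : sys.IsSymmetric G)
    (spl : NonholonomicSplitting EG G sys)
    (A : AffineDiscreteConnection EQ EG G Q)
    {N : ℕ} (q : Fin (N + 1) → Q)
    (hq : ∀ k : Fin N, (q k.castSucc, q k.succ) ∈ A.domain) :
    List.TFAE [
      sys.VariationalPrinciple q,
      sys.Equations q,
      DiscreteSystem.ReducedVariationalPrinciple hP spl A hS q,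
      DiscreteSystem.ReducedEquations hP spl A q] := by
  tfae_have 1 ↔ 2 := DiscreteSystem.variationalPrinciple_iff_equations q
  tfae_have 1 ↔ 3 := DiscreteSystem.variationalPrinciple_iff_reduced hP hS spl hq
  tfae_have 2 ↔ 4 := DiscreteSystem.equations_iff_reduced hP hS spl hq
  tfae_finish
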